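/- Let $m>0$ be a mass parameter (proportional to the gravitational constant $G$) and let spacetime carry the static, spherically symmetric metric, in isotropic quasi-Cartesian coordinates, $$ds^2=\mathcal A(r)\,(dx^0)^2-\mathcal B(r)^{-1}\delta_{ij}dx^i dx^j,\qquad r=|\boldsymbol x|>r_h=k\,m\quad(k>0\text{ fixed}),$$ where $\mathcal A,\mathcal B>0$ and $\mathcal A,\mathcal B^{-1}$ are sums, for $r>r_h$, of power series in $m/r$ with coefficients independent of $m$, $$\mathcal A=1-\frac{2m}{r}+2\beta\frac{m^2}{r^2}+\cdots,\qquad \frac1{\mathcal B}=1+2\gamma\frac mr+\frac32\epsilon\frac{m^2}{r^2}+\cdots .$$ Put $\kappa=\frac14[8(1+\gamma)-4\beta+3\epsilon]$. Let $\boldsymbol x_A,\boldsymbol x_B$ be two points not collinear with the origin, and set $r_{A}=|\boldsymbol x_A|$, $r_B=|\boldsymbol x_B|$, $\boldsymbol n_A=\boldsymbol x_A/r_A$, $\boldsymbol n_B=\boldsymbol x_B/r_B$, $\boldsymbol N=(\boldsymbol x_B-\boldsymbol x_A)/|\boldsymbol x_B-\boldsymbol x_A|$, $\boldsymbol Q=\boldsymbol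 n_A\times\boldsymbol n_B/|\boldsymbol n_A\times\boldsymbol n_B|$, $\boldsymbol P=\boldsymbol N\times\boldsymbol Q$, $r_c=r_Ar_B|\boldsymbol n_A\times\boldsymbol n_B|/|\boldsymbol x_B-\boldsymbol x_A|$. Consider a quasi-Minkowskian light ray from $\boldsymbol x_A$ to $\boldsymbol x_B$: for all $0<m<m_1$ (some $m_1>0$) a null geodesic with affine parameter $\lambda\in[0,1]$, lying in $r>r_h$, of the form $$x^0=x^0_B-\lambda|\boldsymbol x_B-\boldsymbol x_A|+\sum_{n\ge1}m^nX^0_{(n)}(\lambda),\qquad \boldsymbol x=\boldsymbol x_B-\lambda(\boldsymbol x_B-\boldsymbol x_A)+\sum_{n\ge1}m^n\boldsymbol X_{(n)}(\lambda),$$ with $X^0_{(n)}(0)=0$ and $\boldsymbol X_{(n)}(0)=\boldsymbol X_{(n)}(1)=0$. Let $l_\alpha=g_{\alpha\beta}\,dx^\beta/d\lambda$, let $\widehat{\boldsymbol l}=(l_1/l_0,l_2/l_0,l_3/l_0)$ be its direction triple, and let $\widehat{\boldsymbol l}_e$, $\widehat{\boldsymbol l}_r$ be the values of $\widehat{\boldsymbol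 l}$ at $\boldsymbol x_A$ and $\boldsymbol x_B$. Let $b$ be the component along $\boldsymbol Q$ of the angular momentum $\boldsymbol L=-\boldsymbol x\times\widehat{\boldsymbol l}$, evaluated at $\boldsymbol x_A$. Then, for all sufficiently small $m$, $b>0$ and $\boldsymbol L=b\,\boldsymbol Q$ at every point of the ray ($b$ is the intrinsic impact parameter), and as $m\to0$, with $\boldsymbol x_A,\boldsymbol x_B$ fixed, $$b=r_c\Big\{1+\frac{(1+\gamma)m}{r_c}\frac{|\boldsymbol N\times\boldsymbol n_A|+|\boldsymbol N\times\boldsymbol n_B|}{1+\boldsymbol n_A\cdot\boldsymbol n_B}+\frac{m^2}{r_c^2}\Big\{\kappa\Big[1-\frac{\arccos(\boldsymbol n_A\cdot\boldsymbol n_B)}{|\boldsymbol n_A\times\boldsymbol n_B|}(\boldsymbol N\cdot\boldsymbol n_A)(\boldsymbol N\cdot\boldsymbol n_B)\Big]-(1+\gamma)^2\frac{1-(\boldsymbol N\cdot\boldsymbol n_A)(\boldsymbol N\cdot\boldsymbol n_B)}{1+\boldsymbol n_A\cdot\boldsymbol n_B}\Big\}\Big\}+O\Big(\frac{m^3}{r_c^2}\Big),$$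 $$\widehat{\boldsymbol l}_e=-\boldsymbol N-\frac{m|\boldsymbol N\times\boldsymbol n_A|}{b}\Big\{1+\gamma+\frac mb\Big[\kappa|\boldsymbol N\times\boldsymbol n_A|+(1+\gamma)^2\frac{|\boldsymbol N\times\boldsymbol n_B|}{1+\boldsymbol n_A\cdot\boldsymbol n_B}\Big]\Big\}\boldsymbol N$$ $$-\frac{m|\boldsymbol N\times\boldsymbol n_A|}{b}\Big\{(1+\gamma)\frac{|\boldsymbol n_A\times\boldsymbol n_B|}{1+\boldsymbol n_A\cdot\boldsymbol n_B}+\frac{\kappa m}{b}\Big[\frac{\arccos(\boldsymbol n_A\cdot\boldsymbol n_B)}{|\boldsymbol n_A\times\boldsymbol n_B|}\boldsymbol N\cdot\boldsymbol n_B-\boldsymbol N\cdot\boldsymbol n_A\Big]\Big\}\boldsymbol P+O\Big(\frac{m^3}{b^3}\Big),$$ $$\widehat{\boldsymbol l}_r=-\boldsymbol N-\frac{m|\boldsymbol N\times\boldsymbol n_B|}{b}\Big\{1+\gamma+\frac mb\Big[\kappa|\boldsymbol N\times\boldsymbol n_B|+(1+\gamma)^2\frac{|\boldsymbol N\times\boldsymbol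 n_A|}{1+\boldsymbol n_A\cdot\boldsymbol n_B}\Big]\Big\}\boldsymbol N$$ $$+\frac{m|\boldsymbol N\times\boldsymbol n_B|}{b}\Big\{(1+\gamma)\frac{|\boldsymbol n_A\times\boldsymbol n_B|}{1+\boldsymbol n_A\cdot\boldsymbol n_B}-\frac{\kappa m}{b}\Big[\frac{\arccos(\boldsymbol n_A\cdot\boldsymbol n_B)}{|\boldsymbol n_A\times\boldsymbol n_B|}\boldsymbol N\cdot\boldsymbol n_A-\boldsymbol N\cdot\boldsymbol n_B\Big]\Big\}\boldsymbol P+O\Big(\frac{m^3}{b^3}\Big).$$ The constants in the $O$-terms depend only on the metric potentials and on $\boldsymbol x_A,\boldsymbol x_B$, and not on the choice of the ray. -/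

import Mathlib

open Set Filter Topology

noncomputable section

namespace LightRay

/-! ### Spacetime coordinates and the Euclidean vector algebra of triples -/

/-- Triples, regarded as vectors of Euclidean 3-space. -/
abbrev Triple := EuclideanSpace ℝ (Fin 3)

/-- Spacetime events in quasi-Cartesian coordinates: index `0` is `x⁰ = c t`,
the indices `1, 2, 3` are the spatial coordinates. -/
abbrev Event := Fin 4 → ℝ

/-- The spatial triple of an event (or of any quadruple of components). -/
def spatial (x : Event) : Triple := WithLp.toLp 2 (fun i : Fin 3 => x i.succ)

/-- Exterior (cross) product of Euclidean 3-vectors. -/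
def cross (a b : Triple) : Triple := WithLp.toLp 2 (crossProduct a.ofLp b.ofLp)

/-- Euclidean scalar product of triples. -/
def dot (a b : Triple) : ℝ := inner ℝ a b

/-! ### Null geodesics of a metric given in coordinates -/

/-- The tangent vector `dx^α/dλ` of a curve parametrised by `[0, 1]`
(one-sided at the end points). -/
def tangent (X : ℝ → Event) (s : ℝ) : Event := derivWithin X (Icc 0 1) s

/-- Covariant components `l_α = g_{αβ} dx^β/dλ` of the tangent vector. -/
def covTangent (g : Event → Matrix (Fin 4) (Fin 4) ℝ) (X : ℝ → Event) (s : ℝ) (α : Fin 4) : ℝ :=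
  ∑ β, g (X s) α β * tangent X s β

/-- `X` restricted to `[0, 1]` is an affinely parametrised null geodesic of the metric `g`:
the geodesic equation is `d(g_{αβ} ẋ^β)/dλ = ½ ∂_α g_{μν} ẋ^μ ẋ^ν`. -/
structure IsNullGeodesic (g : Event → Matrix (Fin 4) (Fin 4) ℝ) (X : ℝ → Event) : Prop where
  differentiable : DifferentiableOn ℝ X (Icc 0 1)
  geodesic : ∀ s ∈ Icc (0 : ℝ) 1, ∀ α : Fin 4,
    HasDerivWithinAt (fun t => covTangent g X t α)
      (1 / 2 * ∑ μ, ∑ ν, fderiv ℝ (fun y : Event => g y μ ν) (X s) (Pi.single α 1)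
        * tangent X s μ * tangent X s ν) (Icc 0 1) s
  null : ∀ s ∈ Icc (0 : ℝ) 1, ∑ μ, ∑ ν, g (X s) μ ν * tangent X s μ * tangent X s ν = 0

/-- The direction triple `(l_i / l_0)` of the ray at the parameter value `s`. -/
def directionTriple (g : Event → Matrix (Fin 4) (Fin 4) ℝ) (X : ℝ → Event) (s : ℝ) : Triple :=
  WithLp.toLp 2 (fun i : Fin 3 => covTangent g X s i.succ / covTangent g X s 0)

/-- The angular momentum vector `L = - x × (l_i / l_0)` of the ray. -/
def angularMomentum (g : Event → Matrix (Fin 4) (Fin 4) ℝ) (X : ℝ → Event) (s : ℝ) : Triple :=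
  -cross (spatial (X s)) (directionTriple g X s)

/-! ### The static, spherically symmetric metric -/

/-- The metric `ds² = 𝒜(r) (dx⁰)² - 𝓑(r)⁻¹ δ_{ij} dxⁱ dxʲ`, `r = |x|`, for given radial
potentials. -/
def isotropicMetric (A B : ℝ → ℝ) (x : Event) : Matrix (Fin 4) (Fin 4) ℝ :=
  Matrix.diagonal (Fin.cons (A ‖spatial x‖) (fun _ : Fin 3 => -(1 / B ‖spatial x‖)))

/-- The potentials `A m r`, `B m r` (for the mass parameter `m > 0` and the isotropic radius `r`)
are positive for `r > r_h = k m`, and there `𝒜` and `𝓑⁻¹` are sums of power series in `m / r`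
`𝒜 = 1 - 2 m/r + 2 β m²/r² + ⋯`, `𝓑⁻¹ = 1 + 2 γ m/r + (3/2) ε m²/r² + ⋯`. -/
structure IsPostMinkowskianPair (β γ ε k : ℝ) (A B : ℝ → ℝ → ℝ) : Prop where
  k_pos : 0 < k
  posA : ∀ m r : ℝ, 0 < m → k * m < r → 0 < A m r
  posB : ∀ m r : ℝ, 0 < m → k * m < r → 0 < B m r
  expansionA : ∃ a : ℕ → ℝ, a 0 = 1 ∧ a 1 = -2 ∧ a 2 = 2 * β ∧
    ∀ m r : ℝ, 0 < m → k * m < r → HasSum (fun n => a n * (m / r) ^ n) (A m r)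
  expansionB : ∃ q : ℕ → ℝ, q 0 = 1 ∧ q 1 = 2 * γ ∧ q 2 = 3 / 2 * ε ∧
    ∀ m r : ℝ, 0 < m → k * m < r → HasSum (fun n => q n * (m / r) ^ n) (1 / B m r)

/-! ### Quasi-Minkowskian light rays -/

/-- The null line of Minkowski spacetime joining `xA` (at `s = 1`) to `xB` (at `s = 0`), received
at `x⁰ = x0B`. -/
def straightRay (xA xB : Triple) (x0B : ℝ) (s : ℝ) : Event :=
  Fin.cons (x0B - s * ‖xB - xA‖) (fun i : Fin 3 => xB i - s * (xB i - xA i))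

/-- The quasi-Minkowskian light ray joining the point of emission `xA` (parameter value `1`) to
the point of reception `xB` (parameter value `0`), as a function of the mass parameter
`0 < m < m₁`: for each `m` the path `X m` is a null geodesic that lies in the region `r > k m`,
and it is a perturbation of the straight ray by a power series in `m` (that is, in the
gravitational constant, to which `m` is proportional), whose coefficients `c n`, `n ≥ 1`, vanish
at `0` and have spatial parts that vanish at `1`. -/
structure IsQuasiMinkowskian (A B : ℝ → ℝ → ℝ) (k : ℝ) (xA xB : Triple) (x0B m₁ : ℝ)
    (X : ℝ → ℝ → Event) : Prop where
  m₁_pos : 0 < m₁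
  nullGeodesic : ∀ m ∈ Ioo 0 m₁, IsNullGeodesic (isotropicMetric (A m) (B m)) (X m)
  exterior : ∀ m ∈ Ioo 0 m₁, ∀ s ∈ Icc (0 : ℝ) 1, k * m < ‖spatial (X m s)‖
  expansion : ∃ c : ℕ → ℝ → Event,
    (∀ n, 1 ≤ n → c n 0 = 0 ∧ spatial (c n 1) = 0) ∧
    ∀ m ∈ Ioo 0 m₁, ∀ s ∈ Icc (0 : ℝ) 1,
      HasSum (fun n => m ^ (n + 1) • c (n + 1) s) (X m s - straightRay xA xB x0B s)

/-! ### Vectors attached to the two end points -/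

/-- The unit vector `n = x / |x|`. -/
def unit (x : Triple) : Triple := ‖x‖⁻¹ • x

/-- The unit vector `N_AB` pointing from `xA` to `xB`. -/
def vecN (xA xB : Triple) : Triple := unit (xB - xA)

/-- The unit vector `Q_AB = n_A × n_B / |n_A × n_B|`. -/
def vecQ (xA xB : Triple) : Triple := unit (cross (unit xA) (unit xB))

/-- The unit vector `P_AB = N_AB × Q_AB`. -/
def vecP (xA xB : Triple) : Triple := cross (vecN xA xB) (vecQ xA xB)

/-- The impact parameter `b` of the ray `X` from `xA` to `xB`: the component of its angular
momentum (evaluated at emission) along `Q_AB`. -/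
def impactParameter (g : Event → Matrix (Fin 4) (Fin 4) ℝ) (xA xB : Triple) (X : ℝ → Event) : ℝ :=
  dot (angularMomentum g X 1) (vecQ xA xB)

/-- Zeroth-order distance of closest approach `r_c = r_A r_B |n_A × n_B| / |xB - xA|`. -/
def closestApproach (xA xB : Triple) : ℝ :=
  ‖xA‖ * ‖xB‖ * ‖cross (unit xA) (unit xB)‖ / ‖xB - xA‖

/-- The parameter `κ = ¼ [8 (1 + γ) - 4 β + 3 ε]`. -/
def kappa (β γ ε : ℝ) : ℝ := 1 / 4 * (8 * (1 + γ) - 4 * β + 3 * ε)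

/-! ### The second-order expressions -/

/-- The expression for the direction triple at emission, up to order `m²/b²`. -/
def emissionExpansion (β γ ε : ℝ) (xA xB : Triple) (m b : ℝ) : Triple :=
  let nA := unit xA
  let nB := unit xB
  let N := vecN xA xB
  let P := vecP xA xB
  let κ : ℝ := kappa β γ ε;
  -N
  - (m * ‖cross N nA‖ / b *
      (1 + γ + m / b * (κ * ‖cross N nA‖
        + (1 + γ) ^ 2 * (‖cross N nB‖ / (1 + dot nA nB))))) • N
  - (m * ‖cross N nA‖ / b *
      ((1 + γ) * (‖cross nA nB‖ / (1 + dot nA nB))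
        + κ * m / b * (Real.arccos (dot nA nB) / ‖cross nA nB‖ * dot N nB - dot N nA))) • P

/-- The expression for the direction triple at reception, up to order `m²/b²`. -/
def receptionExpansion (β γ ε : ℝ) (xA xB : Triple) (m b : ℝ) : Triple :=
  let nA := unit xA
  let nB := unit xB
  let N := vecN xA xB
  let P := vecP xA xB
  let κ : ℝ := kappa β γ ε;
  -N
  - (m * ‖cross N nB‖ / b *
      (1 + γ + m / b * (κ * ‖cross N nB‖
        + (1 + γ) ^ 2 * (‖cross N nA‖ / (1 + dot nA nB))))) • N
  + (m * ‖cross N nB‖ / b *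
      ((1 + γ) * (‖cross nA nB‖ / (1 + dot nA nB))
        - κ * m / b * (Real.arccos (dot nA nB) / ‖cross nA nB‖ * dot N nA - dot N nB))) • P

/-- The expression for the impact parameter, up to order `m²`. -/
def impactExpansion (β γ ε : ℝ) (xA xB : Triple) (m : ℝ) : ℝ :=
  let nA := unit xA
  let nB := unit xB
  let N := vecN xA xB
  let κ : ℝ := kappa β γ ε;
  let rc := closestApproach xA xB
  rc * (1 + (1 + γ) * m / rc * ((‖cross N nA‖ + ‖cross N nB‖) / (1 + dot nA nB))
    + m ^ 2 / rc ^ 2 *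
      (κ * (1 - Real.arccos (dot nA nB) / ‖cross nA nB‖ * (dot N nA * dot N nB))
        - (1 + γ) ^ 2 * ((1 - dot N nA * dot N nB) / (1 + dot nA nB))))

end LightRay

end

open LightRay

/-! In a static metric l₀ is conserved, and dividing the null geodesic equations by it leaves the
ray equations of an isotropic medium with squared refractive index `fC / fA` = 1 + 2(1+γ)y + 2κy² +
O(y³), y = m/r. This is where κ comes from. The direction triple p plays the part of the momentum:
|p|² is the squared index, and −x × p is conserved. Being orthogonal to both x_A and x_B, the
angular momentum lies along Q, so the motion is planar.

In the axes N, P the end points are (t_A, r_c) and (t_B, r_c). The unknowns are the components (u,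
v) of p at each end, together with b. Five relations determine them: the energy identity at each
end, b = t v − r_c u at each end, and the total change v_A − v_B up to O(m³). For the last one an
explicit primitive is subtracted from v. Along the true ray the derivative of X/r is exactly
proportional to −bY/r³, so the (1+γ) part of the force integrates without any knowledge of the
perturbed trajectory; the κ part already carries m² and needs only the straight line
(`hasDerivWithinAt_deflection`, `RayFamily.deflection_isBigO`). As t_A ≠ t_B, the relations can be
solved order by order (`second_order_expansions`).

The analytic difficulty is that the power series in m is assumed only pointwise in the parameter and
that r > km alone does not make m/r small. Rays are therefore first confined away from the centre: a
speed bound does this on a short initial piece (`RayFamily.staysAway_initial`), which fixes the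
limits of l₀ and of the initial direction; conservation of angular momentum then does it on the
whole ray (`RayFamily.staysAway`). All estimates are taken along the single filter `rayFilter`,
which makes the constants independent of the ray. Parameter value 0 is reception at x_B and 1 is
emission at x_A. -/

noncomputable section

namespace LightRay

open Asymptotics

/-! ### Convergent power series in one real variable -/

/-- A real power series that converges on `(0, ρ)` has an analytic sum on `(-ρ, ρ)`. -/
lemma analyticAt_tsum_of_summable {a : ℕ → ℝ} {ρ : ℝ}
    (h : ∀ y ∈ Ioo 0 ρ, Summable fun n => a n * y ^ n) {y : ℝ} (hy : |y| < ρ) :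
    AnalyticAt ℝ (fun z => ∑' n, a n * z ^ n) y := by
  obtain ⟨z, hyz, hzρ⟩ := exists_between hy
  have hz0 : 0 < z := (abs_nonneg y).trans_lt hyz
  set p := FormalMultilinearSeries.ofScalars ℝ a
  have hrad : ENNReal.ofReal z ≤ p.radius := by
    have ht := (h z ⟨hz0, hzρ⟩).tendsto_atTop_zero.norm
    refine p.le_radius_of_tendsto (r := z.toNNReal) (l := 0) ?_
    have : (fun n => ‖p n‖ * ((z.toNNReal : NNReal) : ℝ) ^ n) = fun n => ‖a n * z ^ n‖ := by
      funext n
      rw [FormalMultilinearSeries.ofScalars_norm, norm_mul, norm_pow, Real.coe_toNNReal _ hz0.le,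
        Real.norm_of_nonneg hz0.le]
    rw [this]; simpa using ht
  have hpos : 0 < p.radius := (ENNReal.ofReal_pos.2 hz0).trans_le hrad
  have hball := p.hasFPowerSeriesOnBall hpos
  have hsum : p.sum = fun z => ∑' n, a n * z ^ n := by
    have := FormalMultilinearSeries.ofScalarsSum_eq_tsum (E := ℝ) a
    simpa [FormalMultilinearSeries.ofScalarsSum, smul_eq_mul] using this
  rw [← hsum]
  refine hball.analyticAt_of_mem ?_
  refine Metric.eball_subset_eball hrad ?_
  rw [Metric.mem_eball, edist_dist, dist_zero_right, Real.norm_eq_abs]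
  exact (ENNReal.ofReal_lt_ofReal_iff hz0).2 hyz

/-- Third order Taylor formula with analytic remainder for a convergent power series. -/
lemma exists_cubic_remainder {a : ℕ → ℝ} {ρ : ℝ} (hρ : 0 < ρ)
    (h : ∀ y ∈ Ioo 0 ρ, Summable fun n => a n * y ^ n) :
    ∃ R : ℝ → ℝ, AnalyticAt ℝ R 0 ∧
      ∀ᶠ y in 𝓝 (0 : ℝ), ∑' n, a n * y ^ n = a 0 + a 1 * y + a 2 * y ^ 2 + y ^ 3 * R y := by
  have hs : ∀ y ∈ Ioo 0 ρ, Summable fun n => a (n + 3) * y ^ n := by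
    intro y hy
    have := ((summable_nat_add_iff 3).2 (h y hy)).mul_right ((y ^ 3)⁻¹)
    refine this.congr fun n => ?_
    have : y ≠ 0 := hy.1.ne'
    field_simp
    ring
  refine ⟨fun y => ∑' n, a (n + 3) * y ^ n, analyticAt_tsum_of_summable hs (by simpa), ?_⟩
  have : Metric.ball (0 : ℝ) ρ ∈ 𝓝 (0 : ℝ) := Metric.ball_mem_nhds _ hρ
  filter_upwards [this] with y hy
  have hy' : |y| < ρ := by simpa using hy
  obtain ⟨z, hyz, hzρ⟩ := exists_between hy'
  have hz0 : 0 < z := (abs_nonneg y).trans_lt hyz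
  have hsy : Summable fun n => a n * y ^ n := by
    refine Summable.of_norm_bounded (h z ⟨hz0, hzρ⟩).norm fun n => ?_
    rw [norm_mul, norm_mul, norm_pow, norm_pow]
    gcongr
    rw [Real.norm_eq_abs, Real.norm_of_nonneg hz0.le]; exact hyz.le
  rw [← hsy.sum_add_tsum_nat_add 3, ← tsum_mul_left]
  simp only [Finset.sum_range_succ, Finset.sum_range_zero, pow_zero, pow_one, mul_one, zero_add]
  congr 1
  refine tsum_congr fun n => ?_
  ring

/-! ### The squared refractive index -/

/-- The metric potentials in terms of `y = m / r`: `𝒜 = fA y`, `𝓑⁻¹ = fC y`, together with the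
second-order expansion of the squared refractive index `fC / fA`. -/
structure IsOpticalProfile (ρ g κ : ℝ) (fA fC : ℝ → ℝ) : Prop where
  radius_pos : 0 < ρ
  differentiableA : ∀ y ∈ Ioo 0 ρ, DifferentiableAt ℝ fA y
  differentiableC : ∀ y ∈ Ioo 0 ρ, DifferentiableAt ℝ fC y
  posA : ∀ y ∈ Ioo 0 ρ, 0 < fA y
  posC : ∀ y ∈ Ioo 0 ρ, 0 < fC y
  linA : (fun y => fA y - 1) =O[𝓝 0] fun y => y
  linC : (fun y => fC y - 1) =O[𝓝 0] fun y => y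
  index : (fun y => fC y / fA y - (1 + 2 * g * y + 2 * κ * y ^ 2)) =O[𝓝 0] fun y => y ^ 3
  derivIndex : (fun y => deriv (fun z => fC z / fA z) y - (2 * g + 4 * κ * y)) =O[𝓝 0]
    fun y => y ^ 2

/-- The potentials depend on m and r only through m/r. The remainder of the quotient is kept in the
form y³ H(y) with H analytic: unlike a bare O(y³) it may be differentiated, which gives the estimate
on the derivative of the index that the momentum equation needs. -/
lemma IsPostMinkowskianPair.exists_opticalProfile {β γ ε k : ℝ} {A B : ℝ → ℝ → ℝ}
    (h : IsPostMinkowskianPair β γ ε k A B) :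
    ∃ fA fC : ℝ → ℝ, IsOpticalProfile (1 / k) (1 + γ) (kappa β γ ε) fA fC ∧
      (∀ m r, 0 < m → k * m < r → A m r = fA (m / r)) ∧
      (∀ m r, 0 < m → k * m < r → 1 / B m r = fC (m / r)) := by
  obtain ⟨a, a0, a1, a2, ha⟩ := h.expansionA
  obtain ⟨q, q0, q1, q2, hq⟩ := h.expansionB
  have hk := h.k_pos
  have hρ : 0 < 1 / k := by positivity
  have key : ∀ y ∈ Ioo 0 (1 / k), 0 < y ∧ k * y < 1 := fun y hy =>
    ⟨hy.1, by have := (lt_div_iff₀ hk).1 hy.2; linarith⟩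
  -- Every admissible ratio y is realised by mass y at radius 1, so this slice recovers both series.
  have hAy : ∀ y ∈ Ioo 0 (1 / k), HasSum (fun n => a n * y ^ n) (A y 1) := fun y hy => by
    simpa using ha y 1 (key y hy).1 (key y hy).2
  have hqy : ∀ y ∈ Ioo 0 (1 / k), HasSum (fun n => q n * y ^ n) (1 / B y 1) := fun y hy => by
    simpa using hq y 1 (key y hy).1 (key y hy).2
  set fA : ℝ → ℝ := fun y => ∑' n, a n * y ^ n with hfA
  set fC : ℝ → ℝ := fun y => ∑' n, q n * y ^ n with hfC
  obtain ⟨RA, hRA, hRA'⟩ := exists_cubic_remainder hρ fun y hy => (hAy y hy).summable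
  obtain ⟨RC, hRC, hRC'⟩ := exists_cubic_remainder hρ fun y hy => (hqy y hy).summable
  have anA : AnalyticAt ℝ fA 0 :=
    analyticAt_tsum_of_summable (fun y hy => (hAy y hy).summable) (by simpa using hρ)
  have anC : AnalyticAt ℝ fC 0 :=
    analyticAt_tsum_of_summable (fun y hy => (hqy y hy).summable) (by simpa using hρ)
  have fA0 : fA 0 = 1 := by have := hRA'.self_of_nhds; simpa [a0] using this
  have fC0 : fC 0 = 1 := by have := hRC'.self_of_nhds; simpa [q0] using this
  have lin : ∀ {f : ℝ → ℝ}, AnalyticAt ℝ f 0 → f 0 = 1 →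
      (fun y => f y - 1) =O[𝓝 0] fun y => y := by
    intro f hf h0
    have := hf.differentiableAt.isBigO_sub
    simpa [h0] using this
  set g := 1 + γ
  set κ := kappa β γ ε with hκ
  -- the numerator of the remainder of `fC / fA`
  set H : ℝ → ℝ := fun y => (RC y - (1 + 2 * g * y + 2 * κ * y ^ 2) * RA y
    + (4 * κ - 4 * β * g) - 4 * β * κ * y) / fA y with hH
  have anH : AnalyticAt ℝ H 0 := by
    refine AnalyticAt.div ?_ anA (by rw [fA0]; norm_num)
    fun_prop
  have hN : (fun y => fC y / fA y) =ᶠ[𝓝 0]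
      fun y => 1 + 2 * g * y + 2 * κ * y ^ 2 + y ^ 3 * H y := by
    have hne : ∀ᶠ y in 𝓝 (0 : ℝ), fA y ≠ 0 :=
      anA.continuousAt.eventually_ne (by rw [fA0]; norm_num)
    filter_upwards [hne, hRA', hRC'] with y hy hA hC
    have e : (1 + 2 * g * y + 2 * κ * y ^ 2 + y ^ 3 * H y) * fA y = fC y := by
      have e1 : H y * fA y = RC y - (1 + 2 * g * y + 2 * κ * y ^ 2) * RA y
        + (4 * κ - 4 * β * g) - 4 * β * κ * y := by rw [hH]; field_simp
      have hA' : fA y = 1 + -2 * y + 2 * β * y ^ 2 + y ^ 3 * RA y := by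
        rw [hfA]; simp only; rw [hA, a0, a1, a2]
      have hC' : fC y = 1 + 2 * γ * y + 3 / 2 * ε * y ^ 2 + y ^ 3 * RC y := by
        rw [hfC]; simp only; rw [hC, q0, q1, q2]
      have : (1 + 2 * g * y + 2 * κ * y ^ 2 + y ^ 3 * H y) * fA y =
        (1 + 2 * g * y + 2 * κ * y ^ 2) * fA y + y ^ 3 * (H y * fA y) := by ring
      rw [this, e1, hC', hA', hκ, kappa]
      ring
    rw [← e]; field_simp
  refine ⟨fA, fC, ⟨hρ, ?_, ?_, ?_, ?_, lin anA fA0, lin anC fC0, ?_, ?_⟩, ?_, ?_⟩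
  · intro y hy
    exact (analyticAt_tsum_of_summable (fun y hy => (hAy y hy).summable)
      (by rw [abs_of_pos hy.1]; exact hy.2)).differentiableAt
  · intro y hy
    exact (analyticAt_tsum_of_summable (fun y hy => (hqy y hy).summable)
      (by rw [abs_of_pos hy.1]; exact hy.2)).differentiableAt
  · intro y hy
    have := h.posA y 1 (key y hy).1 (key y hy).2
    rw [hfA]; simp only; rwa [(hAy y hy).tsum_eq]
  · intro y hy
    have := h.posB y 1 (key y hy).1 (by simpa using (key y hy).2)
    rw [hfC]; simp only; rw [(hqy y hy).tsum_eq]; positivity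
  · have : (fun y => y ^ 3 * H y) =O[𝓝 0] fun y : ℝ => y ^ 3 * 1 :=
      (isBigO_refl _ _).mul (anH.continuousAt.isBigO_one ℝ)
    simp only [mul_one] at this
    refine this.congr' ?_ EventuallyEq.rfl
    filter_upwards [hN] with y hy
    rw [hy]; ring
  · have anH' : AnalyticAt ℝ (deriv H) 0 := anH.deriv
    have h1 : (fun y => y ^ 2 * (3 * H y + y * deriv H y)) =O[𝓝 0] fun y : ℝ => y ^ 2 * 1 := by
      refine (isBigO_refl _ _).mul (Tendsto.isBigO_one ℝ (((continuousAt_const.mul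
        anH.continuousAt).add (continuousAt_id.mul anH'.continuousAt)).tendsto))
    simp only [mul_one] at h1
    refine h1.congr' ?_ EventuallyEq.rfl
    filter_upwards [hN.eventuallyEq_nhds, anH.eventually_analyticAt] with y hy hHy
    rw [hy.deriv_eq]
    have hd : HasDerivAt (fun y => 1 + 2 * g * y + 2 * κ * y ^ 2 + y ^ 3 * H y)
        (2 * g + 2 * κ * (2 * y) + (3 * y ^ 2 * H y + y ^ 3 * deriv H y)) y := by
      have i1 := ((hasDerivAt_id y).const_mul (2 * g)).const_add 1
      have i2 := ((hasDerivAt_id y).pow 2).const_mul (2 * κ)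
      have i3 := ((hasDerivAt_id y).pow 3).mul hHy.differentiableAt.hasDerivAt
      refine ((i1.add i2).add i3).congr_deriv ?_
      simp
    rw [hd.deriv]; ring
  · intro m r hm hr
    have hr0 : 0 < r := (mul_pos hk hm).trans hr
    exact ((ha m r hm hr).tsum_eq).symm
  · intro m r hm hr
    exact ((hq m r hm hr).tsum_eq).symm

/-! ### Reduction of null geodesics to optical rays -/

/-- `spatial` as a continuous linear map. -/
def spatialCLM : Event →L[ℝ] Triple :=
  (PiLp.continuousLinearEquiv 2 ℝ (fun _ : Fin 3 => ℝ)).symm.toContinuousLinearMap.comp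
    (ContinuousLinearMap.pi fun i : Fin 3 => ContinuousLinearMap.proj i.succ)

lemma spatialCLM_apply (y : Event) : spatialCLM y = spatial y := rfl

lemma hasFDerivAt_norm_of_ne_zero {y : Triple} (hy : y ≠ 0) :
    HasFDerivAt (fun z : Triple => ‖z‖) (‖y‖⁻¹ • innerSL ℝ y) y := by
  have h := ((hasStrictFDerivAt_norm_sq y).hasFDerivAt).sqrt (by positivity)
  have e : (fun z : Triple => √(‖z‖ ^ 2)) = fun z => ‖z‖ := by
    funext z; exact Real.sqrt_sq (norm_nonneg z)
  rw [e] at h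
  refine h.congr_fderiv ?_
  ext v
  have : ‖y‖ ≠ 0 := norm_ne_zero_iff.2 hy
  simp [Real.sqrt_sq (norm_nonneg y)]
  field_simp

lemma fderiv_comp_norm_spatial {F : ℝ → ℝ} {F' : ℝ} {y : Event} (hy : spatial y ≠ 0)
    (hF : HasDerivAt F F' ‖spatial y‖) (v : Event) :
    fderiv ℝ (fun z : Event => F ‖spatial z‖) y v
      = F' * (inner ℝ (spatial y) (spatial v) / ‖spatial y‖) := by
  have h1 : HasFDerivAt (fun z : Event => ‖spatial z‖) _ y :=
    (hasFDerivAt_norm_of_ne_zero hy).comp y spatialCLM.hasFDerivAt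
  have h2 := hF.comp_hasFDerivAt y h1
  rw [show (fun z : Event => F ‖spatial z‖) = F ∘ fun z : Event => ‖spatial z‖ from rfl, h2.fderiv]
  simp [spatialCLM_apply]
  left; ring

lemma inner_spatial_single_zero (x : Triple) :
    inner ℝ x (spatial (Pi.single 0 1)) = (0 : ℝ) := by
  have : spatial (Pi.single 0 1) = 0 := by ext i; simp [spatial]
  rw [this, inner_zero_right]

lemma inner_spatial_single_succ (x : Triple) (i : Fin 3) :
    inner ℝ x (spatial (Pi.single i.succ 1)) = x i := by
  have : spatial (Pi.single i.succ 1) = EuclideanSpace.single i (1 : ℝ) := by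
    ext j; simp [spatial, Pi.single_apply]
  rw [this, EuclideanSpace.inner_single_right]; simp

lemma sum_isotropicMetric (A B : ℝ → ℝ) (x v : Event) :
    ∑ μ, ∑ ν, isotropicMetric A B x μ ν * v μ * v ν
      = A ‖spatial x‖ * v 0 ^ 2 - 1 / B ‖spatial x‖ * ‖spatial v‖ ^ 2 := by
  rw [EuclideanSpace.real_norm_sq_eq]
  simp only [isotropicMetric, Matrix.diagonal_apply, ite_mul, zero_mul, Finset.sum_ite_eq,
    Finset.mem_univ, if_true]
  simp [Fin.sum_univ_succ, spatial]
  ring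

lemma sum_fderiv_isotropicMetric {A B : ℝ → ℝ} {x : Event} {A' C' : ℝ} (hx : spatial x ≠ 0)
    (hA : HasDerivAt A A' ‖spatial x‖) (hB : HasDerivAt (fun r => 1 / B r) C' ‖spatial x‖)
    (w v : Event) :
    ∑ μ, ∑ ν, fderiv ℝ (fun y : Event => isotropicMetric A B y μ ν) x w * v μ * v ν
      = (A' * v 0 ^ 2 - C' * ‖spatial v‖ ^ 2)
        * (inner ℝ (spatial x) (spatial w) / ‖spatial x‖) := by
  have h : ∀ μ ν, fderiv ℝ (fun y : Event => isotropicMetric A B y μ ν) x w =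
      if μ = ν then (Fin.cons A' fun _ : Fin 3 => -C' : Fin 4 → ℝ) μ
        * (inner ℝ (spatial x) (spatial w) / ‖spatial x‖) else 0 := by
    intro μ ν
    by_cases e : μ = ν
    · subst e
      simp only [isotropicMetric, Matrix.diagonal_apply_eq, if_true]
      refine Fin.cases ?_ (fun i => ?_) μ
      · simpa using fderiv_comp_norm_spatial hx hA w
      · simpa using fderiv_comp_norm_spatial hx hB.neg w
    · simp [isotropicMetric, e]
  simp only [h, ite_mul, zero_mul, Finset.sum_ite_eq, Finset.mem_univ, if_true]
  rw [EuclideanSpace.real_norm_sq_eq]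
  simp [Fin.sum_univ_succ, spatial]
  ring

lemma covTangent_zero (A B : ℝ → ℝ) (X : ℝ → Event) (s : ℝ) :
    covTangent (isotropicMetric A B) X s 0 = A ‖spatial (X s)‖ * tangent X s 0 := by
  simp [covTangent, isotropicMetric, Matrix.diagonal_apply]

lemma covTangent_succ (A B : ℝ → ℝ) (X : ℝ → Event) (s : ℝ) (i : Fin 3) :
    covTangent (isotropicMetric A B) X s i.succ
      = -(1 / B ‖spatial (X s)‖ * tangent X s i.succ) := by
  simp [covTangent, isotropicMetric, Matrix.diagonal_apply]

lemma hasDerivWithinAt_toLp {f : ℝ → Fin 3 → ℝ} {f' : Fin 3 → ℝ} {S : Set ℝ} {s : ℝ}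
    (h : ∀ i, HasDerivWithinAt (fun t => f t i) (f' i) S s) :
    HasDerivWithinAt (fun t => (WithLp.toLp 2 (f t) : Triple)) (WithLp.toLp 2 f') S s :=
  (PiLp.continuousLinearEquiv 2 ℝ (fun _ : Fin 3 => ℝ)).symm.toContinuousLinearMap.hasFDerivAt
    |>.comp_hasDerivWithinAt s (hasDerivWithinAt_pi.2 h)

/-- The Hamiltonian form of the equations of light rays in a medium with squared refractive
index `fC / fA`; `t`, `x` are the time and position, `p` is the direction triple. -/
structure IsOpticalRay (ρ : ℝ) (fA fC : ℝ → ℝ) (m : ℝ) (t : ℝ → ℝ) (x p : ℝ → Triple)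
    (l0 : ℝ) : Prop where
  neg : l0 < 0
  ne_zero : ∀ s ∈ Icc (0 : ℝ) 1, x s ≠ 0
  exterior : ∀ s ∈ Icc (0 : ℝ) 1, m / ‖x s‖ ∈ Ioo 0 ρ
  time : ∀ s ∈ Icc (0 : ℝ) 1, HasDerivWithinAt t (l0 / fA (m / ‖x s‖)) (Icc 0 1) s
  position : ∀ s ∈ Icc (0 : ℝ) 1,
    HasDerivWithinAt x ((-l0 / fC (m / ‖x s‖)) • p s) (Icc 0 1) s
  momentum : ∀ s ∈ Icc (0 : ℝ) 1,
    HasDerivWithinAt p ((-l0 / fC (m / ‖x s‖)) •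
      (-(1 / 2 * deriv (fun z => fC z / fA z) (m / ‖x s‖) * m / ‖x s‖ ^ 3)) • x s) (Icc 0 1) s
  energy : ∀ s ∈ Icc (0 : ℝ) 1, ‖p s‖ ^ 2 = fC (m / ‖x s‖) / fA (m / ‖x s‖)

lemma hasDerivAt_comp_div {F f : ℝ → ℝ} {m k r : ℝ} (hF : ∀ z, k * m < z → F z = f (m / z))
    (hr : k * m < r) (hr0 : r ≠ 0) (hf : DifferentiableAt ℝ f (m / r)) :
    HasDerivAt F (deriv f (m / r) * (-m / r ^ 2)) r := by
  have h1 : HasDerivAt (fun z => m / z) (-m / r ^ 2) r := by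
    exact ((hasDerivAt_const r m).div (hasDerivAt_id r) hr0).congr_deriv (by simp)
  refine (hf.hasDerivAt.comp r h1).congr_of_eventuallyEq ?_
  filter_upwards [lt_mem_nhds hr] with z hz
  exact hF z hz

/-- The time component of the geodesic equation gives conservation of l₀; the spatial components
divided by l₀ give the momentum equation, with |dx/dλ|² eliminated by the null condition. The
comparison of times at `s₀` and 0 serves only to fix the sign of l₀. -/
lemma IsNullGeodesic.isOpticalRay {k g κ m s₀ : ℝ} {A B fA fC : ℝ → ℝ} {X : ℝ → Event}
    (hk : 0 < k) (hm : 0 < m) (hf : IsOpticalProfile (1 / k) g κ fA fC)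
    (hA : ∀ r, k * m < r → A r = fA (m / r)) (hB : ∀ r, k * m < r → 1 / B r = fC (m / r))
    (hX : IsNullGeodesic (isotropicMetric A B) X)
    (hext : ∀ s ∈ Icc (0 : ℝ) 1, k * m < ‖spatial (X s)‖) (hs₀ : s₀ ∈ Icc (0 : ℝ) 1)
    (ht : X s₀ 0 < X 0 0) :
    IsOpticalRay (1 / k) fA fC m (fun s => X s 0) (fun s => spatial (X s))
      (directionTriple (isotropicMetric A B) X) (covTangent (isotropicMetric A B) X 0 0) := by
  set l0 := covTangent (isotropicMetric A B) X 0 0 with hl0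
  have hr0 : ∀ s ∈ Icc (0 : ℝ) 1, 0 < ‖spatial (X s)‖ := fun s hs =>
    (mul_pos hk hm).trans (hext s hs)
  have hne : ∀ s ∈ Icc (0 : ℝ) 1, spatial (X s) ≠ 0 := fun s hs => norm_pos_iff.1 (hr0 s hs)
  have hy : ∀ s ∈ Icc (0 : ℝ) 1, m / ‖spatial (X s)‖ ∈ Ioo 0 (1 / k) := fun s hs =>
    ⟨div_pos hm (hr0 s hs), by
      rw [div_lt_div_iff₀ (hr0 s hs) hk]; have := hext s hs; linarith⟩
  have hdX : ∀ s ∈ Icc (0 : ℝ) 1, HasDerivWithinAt X (tangent X s) (Icc 0 1) s := fun s hs =>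
    (hX.differentiable s hs).hasDerivWithinAt
  have hdA : ∀ s ∈ Icc (0 : ℝ) 1, HasDerivAt A _ ‖spatial (X s)‖ := fun s hs =>
    hasDerivAt_comp_div hA (hext s hs) (hr0 s hs).ne' (hf.differentiableA _ (hy s hs))
  have hdC : ∀ s ∈ Icc (0 : ℝ) 1, HasDerivAt (fun r => 1 / B r) _ ‖spatial (X s)‖ := fun s hs =>
    hasDerivAt_comp_div hB (hext s hs) (hr0 s hs).ne' (hf.differentiableC _ (hy s hs))
  have hconst : ∀ s ∈ Icc (0 : ℝ) 1, covTangent (isotropicMetric A B) X s 0 = l0 := by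
    have hd : ∀ s ∈ Icc (0 : ℝ) 1,
        HasDerivWithinAt (fun s => covTangent (isotropicMetric A B) X s 0) 0 (Icc 0 1) s := by
      intro s hs
      have := hX.geodesic s hs 0
      rw [sum_fderiv_isotropicMetric (hne s hs) (hdA s hs) (hdC s hs),
        inner_spatial_single_zero] at this
      simpa using this
    intro s hs
    have := (convex_Icc (0 : ℝ) 1).norm_image_sub_le_of_norm_hasDerivWithin_le (C := 0) hd
      (fun x _ => by simp) (left_mem_Icc.2 zero_le_one) hs
    simpa [sub_eq_zero] using this
  have htan0 : ∀ s ∈ Icc (0 : ℝ) 1, tangent X s 0 = l0 / fA (m / ‖spatial (X s)‖) := by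
    intro s hs
    rw [← hconst s hs, covTangent_zero, hA _ (hext s hs)]
    field_simp [(hf.posA _ (hy s hs)).ne']
  have htime : ∀ s ∈ Icc (0 : ℝ) 1, HasDerivWithinAt (fun s => X s 0)
      (l0 / fA (m / ‖spatial (X s)‖)) (Icc 0 1) s := fun s hs => by
    rw [← htan0 s hs]
    exact hasDerivWithinAt_pi.1 (hdX s hs) 0
  -- If l₀ ≥ 0 the time would be nondecreasing in the parameter, against `ht`.
  have hneg : l0 < 0 := by
    by_contra hcon
    push Not at hcon
    have hmono : MonotoneOn (fun s => X s 0) (Icc 0 1) := by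
      refine monotoneOn_of_hasDerivWithinAt_nonneg (convex_Icc 0 1)
        (f' := fun s => l0 / fA (m / ‖spatial (X s)‖))
        (fun s hs => (htime s hs).continuousWithinAt)
        (fun s hs => (htime s (interior_subset hs)).mono interior_subset) ?_
      intro s hs
      exact div_nonneg hcon (hf.posA _ (hy s (interior_subset hs))).le
    exact absurd (hmono (left_mem_Icc.2 zero_le_one) hs₀ hs₀.1) (not_le.2 ht)
  have hcov : ∀ s ∈ Icc (0 : ℝ) 1, ∀ i : Fin 3, tangent X s i.succ
      = (-l0 / fC (m / ‖spatial (X s)‖)) * directionTriple (isotropicMetric A B) X s i := by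
    intro s hs i
    have h1 := (hf.posC _ (hy s hs)).ne'
    simp only [directionTriple]
    rw [hconst s hs, covTangent_succ, hB _ (hext s hs)]
    have := hneg.ne
    field_simp
  have htanv : ∀ s ∈ Icc (0 : ℝ) 1, spatial (tangent X s)
      = (-l0 / fC (m / ‖spatial (X s)‖)) • directionTriple (isotropicMetric A B) X s := by
    intro s hs
    ext i
    simpa [spatial] using hcov s hs i
  have hnull : ∀ s ∈ Icc (0 : ℝ) 1,
      fC (m / ‖spatial (X s)‖) * ‖spatial (tangent X s)‖ ^ 2
        = l0 ^ 2 / fA (m / ‖spatial (X s)‖) := by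
    intro s hs
    have := hX.null s hs
    rw [sum_isotropicMetric, hB _ (hext s hs), hA _ (hext s hs), htan0 s hs] at this
    have h1 := (hf.posA _ (hy s hs)).ne'
    rw [sub_eq_zero] at this
    rw [← this]
    field_simp
  refine ⟨hneg, hne, hy, htime, ?_, ?_, ?_⟩
  · intro s hs
    rw [← htanv s hs]
    exact spatialCLM.hasFDerivAt.comp_hasDerivWithinAt s (hdX s hs)
  · intro s hs
    have hC := (hf.posC _ (hy s hs)).ne'
    have hAp := (hf.posA _ (hy s hs)).ne'
    have hr := (hr0 s hs).ne'
    have hN : deriv (fun z => fC z / fA z) (m / ‖spatial (X s)‖) = _ :=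
      ((hf.differentiableC _ (hy s hs)).hasDerivAt.div
        (hf.differentiableA _ (hy s hs)).hasDerivAt hAp).deriv
    have hv : ‖spatial (tangent X s)‖ ^ 2
        = l0 ^ 2 / fA (m / ‖spatial (X s)‖) / fC (m / ‖spatial (X s)‖) := by
      rw [← hnull s hs]; field_simp
    have key : ∀ i : Fin 3, HasDerivWithinAt (fun s =>
        covTangent (isotropicMetric A B) X s i.succ / l0) (((-l0 / fC (m / ‖spatial (X s)‖)) •
        (-(1 / 2 * deriv (fun z => fC z / fA z) (m / ‖spatial (X s)‖) * m / ‖spatial (X s)‖ ^ 3))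
          • spatial (X s)) i) (Icc 0 1) s := by
      intro i
      refine ((hX.geodesic s hs i.succ).div_const l0).congr_deriv ?_
      rw [sum_fderiv_isotropicMetric (hne s hs) (hdA s hs) (hdC s hs),
        inner_spatial_single_succ, htan0 s hs, hv, hN]
      have := hneg.ne
      simp only [PiLp.smul_apply, smul_eq_mul]
      field_simp
      ring
    refine (hasDerivWithinAt_toLp key).congr (fun z hz => ?_) ?_
    · ext i; simp only [directionTriple]; rw [hconst z hz]
    · ext i; simp only [directionTriple]; rw [hconst s hs]
  · intro s hs
    have h2 := hnull s hs
    have hC := (hf.posC _ (hy s hs)).ne'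
    have hAp := (hf.posA _ (hy s hs)).ne'
    have := hneg.ne
    rw [htanv s hs, norm_smul, mul_pow, Real.norm_eq_abs, sq_abs] at h2
    field_simp at h2 ⊢
    linarith

/-! ### Vector algebra -/

lemma dot_eq (a b : Triple) : dot a b = a 0 * b 0 + a 1 * b 1 + a 2 * b 2 := by
  simp [dot, PiLp.inner_apply, Fin.sum_univ_three]; ring

lemma norm_sq_eq_dot (a : Triple) : ‖a‖ ^ 2 = dot a a := (real_inner_self_eq_norm_sq a).symm

lemma cross_zero_coord (a b : Triple) : cross a b 0 = a 1 * b 2 - a 2 * b 1 := by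
  simp [cross, cross_apply]

lemma cross_one_coord (a b : Triple) : cross a b 1 = a 2 * b 0 - a 0 * b 2 := by
  simp [cross, cross_apply]

lemma cross_two_coord (a b : Triple) : cross a b 2 = a 0 * b 1 - a 1 * b 0 := by
  simp [cross, cross_apply]

lemma triple_ext {a b : Triple} (h0 : a 0 = b 0) (h1 : a 1 = b 1) (h2 : a 2 = b 2) : a = b := by
  ext i; fin_cases i <;> assumption

lemma cross_smul_left (c : ℝ) (a b : Triple) : cross (c • a) b = c • cross a b := by
  apply triple_ext <;>
    simp only [cross_zero_coord, cross_one_coord, cross_two_coord, PiLp.smul_apply, smul_eq_mul] <;>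
    ring

lemma cross_smul_right (c : ℝ) (a b : Triple) : cross a (c • b) = c • cross a b := by
  apply triple_ext <;>
    simp only [cross_zero_coord, cross_one_coord, cross_two_coord, PiLp.smul_apply, smul_eq_mul] <;>
    ring

lemma cross_self_eq_zero (a : Triple) : cross a a = 0 := by
  apply triple_ext <;>
    simp only [cross_zero_coord, cross_one_coord, cross_two_coord, PiLp.zero_apply] <;> ring

lemma cross_sub_right (a b c : Triple) : cross a (b - c) = cross a b - cross a c := by
  apply triple_ext <;>
    simp only [cross_zero_coord, cross_one_coord, cross_two_coord, PiLp.sub_apply] <;> ring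

lemma cross_sub_left (a b c : Triple) : cross (a - b) c = cross a c - cross b c := by
  apply triple_ext <;>
    simp only [cross_zero_coord, cross_one_coord, cross_two_coord, PiLp.sub_apply] <;> ring

lemma cross_swap (a b : Triple) : cross a b = -cross b a := by
  apply triple_ext <;>
    simp only [cross_zero_coord, cross_one_coord, cross_two_coord, PiLp.neg_apply] <;> ring

lemma dot_cross_cross (a b c d : Triple) :
    dot (cross a b) (cross c d) = dot a c * dot b d - dot a d * dot b c := by
  simp only [dot_eq, cross_zero_coord, cross_one_coord, cross_two_coord]; ring

lemma dot_cross_cyclic (a b c : Triple) : dot a (cross b c) = dot (cross a b) c := by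
  simp only [dot_eq, cross_zero_coord, cross_one_coord, cross_two_coord]; ring

lemma dot_cross_left (a b : Triple) : dot a (cross a b) = 0 := by
  simp only [dot_eq, cross_zero_coord, cross_one_coord, cross_two_coord]; ring

lemma dot_cross_right (a b : Triple) : dot b (cross a b) = 0 := by
  simp only [dot_eq, cross_zero_coord, cross_one_coord, cross_two_coord]; ring

lemma cross_cross_right (a b c : Triple) : cross a (cross b c) = dot a c • b - dot a b • c := by
  apply triple_ext <;>
    simp only [dot_eq, cross_zero_coord, cross_one_coord, cross_two_coord, PiLp.sub_apply,
      PiLp.smul_apply, smul_eq_mul] <;> ring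

lemma norm_cross_sq (a b : Triple) : ‖cross a b‖ ^ 2 = ‖a‖ ^ 2 * ‖b‖ ^ 2 - dot a b ^ 2 := by
  simp only [norm_sq_eq_dot, dot_cross_cross]
  simp only [dot_eq]; ring

lemma norm_cross_le (a b : Triple) : ‖cross a b‖ ≤ ‖a‖ * ‖b‖ := by
  refine abs_le_of_sq_le_sq' ?_ (by positivity) |>.2
  rw [norm_cross_sq, mul_pow]; nlinarith [sq_nonneg (dot a b)]

lemma dot_comm (a b : Triple) : dot a b = dot b a := by simp only [dot_eq]; ring

lemma dot_smul_left (c : ℝ) (a b : Triple) : dot (c • a) b = c * dot a b := by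
  simp only [dot_eq, PiLp.smul_apply, smul_eq_mul]; ring

lemma dot_smul_right (c : ℝ) (a b : Triple) : dot a (c • b) = c * dot a b := by
  simp only [dot_eq, PiLp.smul_apply, smul_eq_mul]; ring

lemma dot_sub_left (a b c : Triple) : dot (a - b) c = dot a c - dot b c := by
  simp only [dot_eq, PiLp.sub_apply]; ring

lemma dot_add_left (a b c : Triple) : dot (a + b) c = dot a c + dot b c := by
  simp only [dot_eq, PiLp.add_apply]; ring

/-- For arbitrary N and Q the Gram-determinant form of the decomposition is a polynomial identity in
coordinates; orthonormality is substituted only at the end. -/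
lemma eq_of_orthonormal {N Q : Triple} (hN : dot N N = 1) (hQ : dot Q Q = 1) (hNQ : dot N Q = 0)
    (v : Triple) : v = dot v N • N + dot v Q • Q + dot v (cross N Q) • cross N Q := by
  have h : (dot N N * dot Q Q - dot N Q ^ 2) • v =
      (dot v N * dot Q Q - dot v Q * dot N Q) • N + (dot v Q * dot N N - dot v N * dot N Q) • Q
        + dot v (cross N Q) • cross N Q := by
    apply triple_ext <;>
      simp only [dot_eq, cross_zero_coord, cross_one_coord, cross_two_coord, PiLp.add_apply,
        PiLp.smul_apply, smul_eq_mul] <;> ring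
  simpa [hN, hQ, hNQ] using h

lemma hasDerivWithinAt_cross {f h : ℝ → Triple} {f' h' : Triple} {S : Set ℝ} {s : ℝ}
    (hf : HasDerivWithinAt f f' S s) (hh : HasDerivWithinAt h h' S s) :
    HasDerivWithinAt (fun t => cross (f t) (h t)) (cross f' (h s) + cross (f s) h') S s := by
  have cf : ∀ i, HasDerivWithinAt (fun t => f t i) (f' i) S s := fun i =>
    (EuclideanSpace.proj (𝕜 := ℝ) i).hasFDerivAt.comp_hasDerivWithinAt s hf
  have ch : ∀ i, HasDerivWithinAt (fun t => h t i) (h' i) S s := fun i =>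
    (EuclideanSpace.proj (𝕜 := ℝ) i).hasFDerivAt.comp_hasDerivWithinAt s hh
  refine hasDerivWithinAt_toLp (f := fun t => crossProduct (f t).ofLp (h t).ofLp)
    (f' := (cross f' (h s) + cross (f s) h').ofLp) fun i => ?_
  fin_cases i
  · refine ((((cf 1).mul (ch 2)).sub ((cf 2).mul (ch 1))).congr_deriv ?_).congr_of_eventuallyEq
      (Eventually.of_forall fun t => cross_zero_coord (f t) (h t)) (cross_zero_coord (f s) (h s))
    simp [cross_zero_coord]; ring
  · refine ((((cf 2).mul (ch 0)).sub ((cf 0).mul (ch 2))).congr_deriv ?_).congr_of_eventuallyEq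
      (Eventually.of_forall fun t => cross_one_coord (f t) (h t)) (cross_one_coord (f s) (h s))
    simp [cross_one_coord]; ring
  · refine ((((cf 0).mul (ch 1)).sub ((cf 1).mul (ch 0))).congr_deriv ?_).congr_of_eventuallyEq
      (Eventually.of_forall fun t => cross_two_coord (f t) (h t)) (cross_two_coord (f s) (h s))
    simp [cross_two_coord]; ring

/-! ### The frame attached to the end points -/

lemma unit_smul {c : ℝ} (hc : 0 < c) (v : Triple) : unit (c • v) = unit v := by
  simp only [unit, norm_smul, Real.norm_of_nonneg hc.le, smul_smul, mul_inv]
  congr 1; field_simp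

lemma norm_unit {v : Triple} (hv : v ≠ 0) : ‖unit v‖ = 1 := by
  have : ‖v‖ ≠ 0 := norm_ne_zero_iff.2 hv
  simp [unit, norm_smul, this]

lemma left_ne_zero_of_cross {xA xB : Triple} (hx : cross xA xB ≠ 0) : xA ≠ 0 := by
  rintro rfl; exact hx (by simpa using cross_smul_left 0 0 xB)

lemma right_ne_zero_of_cross {xA xB : Triple} (hx : cross xA xB ≠ 0) : xB ≠ 0 := by
  rintro rfl; exact hx (by simpa using cross_smul_right 0 xA 0)

lemma sub_ne_zero_of_cross {xA xB : Triple} (hx : cross xA xB ≠ 0) : xB - xA ≠ 0 := by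
  intro h
  rw [sub_eq_zero] at h
  rw [h] at hx
  exact hx (cross_self_eq_zero _)

lemma vecQ_eq {xA xB : Triple} (hx : cross xA xB ≠ 0)
    : vecQ xA xB = ‖cross xA xB‖⁻¹ • cross xA xB := by
  have hA := norm_pos_iff.2 (left_ne_zero_of_cross hx)
  have hB := norm_pos_iff.2 (right_ne_zero_of_cross hx)
  rw [vecQ]
  simp only [unit.eq_def xA, unit.eq_def xB, cross_smul_left, cross_smul_right]
  rw [unit_smul (by positivity), unit_smul (by positivity), unit]

lemma dot_vecN_self {xA xB : Triple} (hx : cross xA xB ≠ 0)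
    : dot (vecN xA xB) (vecN xA xB) = 1 := by
  rw [← norm_sq_eq_dot, vecN, norm_unit (sub_ne_zero_of_cross hx)]; norm_num

lemma dot_vecQ_self {xA xB : Triple} (hx : cross xA xB ≠ 0)
    : dot (vecQ xA xB) (vecQ xA xB) = 1 := by
  have : ‖cross xA xB‖ ≠ 0 := norm_ne_zero_iff.2 hx
  rw [← norm_sq_eq_dot, vecQ_eq hx, norm_smul, norm_inv, norm_norm]; field_simp

lemma dot_left_vecQ {xA xB : Triple} (hx : cross xA xB ≠ 0) : dot xA (vecQ xA xB) = 0 := by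
  rw [vecQ_eq hx, dot_smul_right, dot_cross_left, mul_zero]

lemma dot_right_vecQ {xA xB : Triple} (hx : cross xA xB ≠ 0) : dot xB (vecQ xA xB) = 0 := by
  rw [vecQ_eq hx, dot_smul_right, dot_cross_right, mul_zero]

lemma dot_vecN_vecQ {xA xB : Triple} (hx : cross xA xB ≠ 0)
    : dot (vecN xA xB) (vecQ xA xB) = 0 := by
  rw [vecN, unit, dot_smul_left, dot_sub_left, dot_left_vecQ hx, dot_right_vecQ hx]; simp

lemma dot_vecN_vecP {xA xB : Triple} : dot (vecN xA xB) (vecP xA xB) = 0 := dot_cross_left _ _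

/-- The decomposition of a vector of the plane of motion. -/
lemma eq_of_dot_vecQ_eq_zero {xA xB : Triple} (hx : cross xA xB ≠ 0)
    {v : Triple} (hv : dot v (vecQ xA xB) = 0) :
    v = dot v (vecN xA xB) • vecN xA xB + dot v (vecP xA xB) • vecP xA xB := by
  have := eq_of_orthonormal (dot_vecN_self hx) (dot_vecQ_self hx) (dot_vecN_vecQ hx) v
  rw [hv, zero_smul, add_zero] at this
  exact this

lemma norm_sq_of_dot_vecQ_eq_zero {xA xB : Triple} (hx : cross xA xB ≠ 0)
    {v : Triple} (hv : dot v (vecQ xA xB) = 0) :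
    ‖v‖ ^ 2 = dot v (vecN xA xB) ^ 2 + dot v (vecP xA xB) ^ 2 := by
  have h : dot v v = dot v (dot v (vecN xA xB) • vecN xA xB + dot v (vecP xA xB) • vecP xA xB) := by
    rw [← eq_of_dot_vecQ_eq_zero hx hv]
  rw [norm_sq_eq_dot, h, dot_comm, dot_add_left, dot_smul_left, dot_smul_left, dot_comm _ v,
    dot_comm _ v]
  ring

/-- The component along `Q` of the angular momentum in terms of planar coordinates. -/
lemma dot_neg_cross_vecQ {xA xB : Triple} (hx : cross xA xB ≠ 0)
    (x p : Triple) : dot (-cross x p) (vecQ xA xB) =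
    dot x (vecN xA xB) * dot p (vecP xA xB) - dot x (vecP xA xB) * dot p (vecN xA xB) := by
  rw [← dot_cross_cross x p, vecP, cross_cross_right, dot_vecN_self hx, dot_vecN_vecQ hx]
  simp only [dot_eq, PiLp.neg_apply, PiLp.sub_apply, PiLp.smul_apply, smul_eq_mul]; ring

lemma closestApproach_eq {xA xB : Triple} (hx : cross xA xB ≠ 0)
    : closestApproach xA xB = ‖cross xA xB‖ / ‖xB - xA‖ := by
  have hA := norm_pos_iff.2 (left_ne_zero_of_cross hx)
  have hB := norm_pos_iff.2 (right_ne_zero_of_cross hx)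
  simp only [closestApproach, unit, cross_smul_left, cross_smul_right, norm_smul, norm_inv,
    norm_norm]
  field_simp

lemma closestApproach_pos {xA xB : Triple} (hx : cross xA xB ≠ 0) : 0 < closestApproach xA xB := by
  rw [closestApproach_eq hx]
  exact div_pos (norm_pos_iff.2 hx) (norm_pos_iff.2 (sub_ne_zero_of_cross hx))

/-- The chord is parallel to N, so both end points have the same coordinate along P, namely the
distance of the chord from the centre. -/
lemma dot_left_vecP {xA xB : Triple} (hx : cross xA xB ≠ 0)
    : dot xA (vecP xA xB) = closestApproach xA xB := by
  have h : ‖cross xA xB‖ ≠ 0 := norm_ne_zero_iff.2 hx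
  rw [closestApproach_eq hx, vecP, dot_cross_cyclic, vecN, unit, cross_smul_right, cross_sub_right,
    cross_self_eq_zero, sub_zero, dot_smul_left, vecQ_eq hx, dot_smul_right, ← norm_sq_eq_dot]
  field_simp

lemma dot_right_vecP {xA xB : Triple} (hx : cross xA xB ≠ 0)
    : dot xB (vecP xA xB) = closestApproach xA xB := by
  have h : ‖cross xA xB‖ ≠ 0 := norm_ne_zero_iff.2 hx
  rw [closestApproach_eq hx, vecP, dot_cross_cyclic, vecN, unit, cross_smul_right, cross_sub_right,
    cross_self_eq_zero, zero_sub, ← cross_swap xA xB, dot_smul_left, vecQ_eq hx, dot_smul_right,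
    ← norm_sq_eq_dot]
  field_simp

lemma dot_right_vecN_sub {xA xB : Triple} (hx : cross xA xB ≠ 0)
    : dot xB (vecN xA xB) - dot xA (vecN xA xB) = ‖xB - xA‖ := by
  have h : ‖xB - xA‖ ≠ 0 := norm_ne_zero_iff.2 (sub_ne_zero_of_cross hx)
  rw [← dot_sub_left, vecN, unit, dot_smul_right, ← norm_sq_eq_dot]; field_simp

lemma norm_sq_left {xA xB : Triple} (hx : cross xA xB ≠ 0)
    : ‖xA‖ ^ 2 = dot xA (vecN xA xB) ^ 2 + closestApproach xA xB ^ 2 := by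
  rw [norm_sq_of_dot_vecQ_eq_zero hx (dot_left_vecQ hx), dot_left_vecP hx]

lemma norm_sq_right {xA xB : Triple} (hx : cross xA xB ≠ 0)
    : ‖xB‖ ^ 2 = dot xB (vecN xA xB) ^ 2 + closestApproach xA xB ^ 2 := by
  rw [norm_sq_of_dot_vecQ_eq_zero hx (dot_right_vecQ hx), dot_right_vecP hx]

lemma dot_unit_unit {xA xB : Triple} (hx : cross xA xB ≠ 0) : dot (unit xA) (unit xB) =
    (dot xA (vecN xA xB) * dot xB (vecN xA xB) + closestApproach xA xB ^ 2)
      / (‖xA‖ * ‖xB‖) := by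
  have h : dot xA xB = dot xA
      (dot xB (vecN xA xB) • vecN xA xB + dot xB (vecP xA xB) • vecP xA xB) := by
    rw [← eq_of_dot_vecQ_eq_zero hx (dot_right_vecQ hx)]
  rw [unit, unit, dot_smul_left, dot_smul_right, h, dot_comm, dot_add_left, dot_smul_left,
    dot_smul_left, dot_comm _ xA, dot_comm _ xA, dot_left_vecP hx, dot_right_vecP hx]
  field_simp

lemma norm_cross_unit_unit {xA xB : Triple} (hx : cross xA xB ≠ 0) : ‖cross (unit xA) (unit xB)‖ =
    closestApproach xA xB * ‖xB - xA‖ / (‖xA‖ * ‖xB‖) := by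
  have hA := norm_pos_iff.2 (left_ne_zero_of_cross hx)
  have hB := norm_pos_iff.2 (right_ne_zero_of_cross hx)
  have h : ‖xB - xA‖ ≠ 0 := norm_ne_zero_iff.2 (sub_ne_zero_of_cross hx)
  rw [closestApproach]; field_simp

lemma norm_cross_vecN_left {xA xB : Triple} (hx : cross xA xB ≠ 0)
    : ‖cross (vecN xA xB) (unit xA)‖ = closestApproach xA xB / ‖xA‖ := by
  rw [closestApproach_eq hx, vecN, unit, unit, cross_smul_left, cross_smul_right, cross_sub_left,
    cross_self_eq_zero, sub_zero, norm_smul, norm_smul, cross_swap xB xA, norm_neg, norm_inv,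
    norm_inv, norm_norm, norm_norm]
  ring

lemma norm_cross_vecN_right {xA xB : Triple} (hx : cross xA xB ≠ 0)
    : ‖cross (vecN xA xB) (unit xB)‖ = closestApproach xA xB / ‖xB‖ := by
  rw [closestApproach_eq hx, vecN, unit, unit, cross_smul_left, cross_smul_right, cross_sub_left,
    cross_self_eq_zero, zero_sub, norm_smul, norm_smul, norm_neg, norm_inv,
    norm_inv, norm_norm, norm_norm]
  ring

lemma dot_vecN_unit {xA xB : Triple} (x : Triple) : dot (vecN xA xB) (unit x) = dot x (vecN xA xB) / ‖x‖ := by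
  rw [dot_comm, unit, dot_smul_left]; ring

/-! ### Uniform estimates along a filter of rays -/

section Tools

variable {ι : Type*} {l : Filter ι} {a : ℝ}

/-- A uniform bound on derivatives gives a uniform bound on increments. -/
lemma isBigO_sub_of_hasDerivWithinAt {E : Type*} [NormedAddCommGroup E] [NormedSpace ℝ E]
    (ha : 0 ≤ a) {G G' : ι → ℝ → E} {e : ι → ℝ}
    (hd : ∀ᶠ i in l, ∀ s ∈ Icc 0 a, HasDerivWithinAt (G i) (G' i s) (Icc 0 a) s)
    (hb : (fun q : ι × ℝ => G' q.1 q.2) =O[l ×ˢ 𝓟 (Icc 0 a)] fun q => e q.1) :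
    (fun q : ι × ℝ => G q.1 q.2 - G q.1 0) =O[l ×ˢ 𝓟 (Icc 0 a)] fun q => e q.1 := by
  obtain ⟨C, hC, hb⟩ := hb.exists_pos
  rw [isBigOWith_iff, eventually_prod_principal_iff] at hb
  refine IsBigO.of_bound (C * a) ?_
  rw [eventually_prod_principal_iff]
  filter_upwards [hd, hb] with i hd hb s hs
  have h := (convex_Icc 0 a).norm_image_sub_le_of_norm_hasDerivWithin_le hd hb
    (left_mem_Icc.2 ha) hs
  refine h.trans ?_
  rw [sub_zero, Real.norm_of_nonneg hs.1, mul_right_comm]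
  have := hs.2
  gcongr

lemma tendsto_prodMk_principal {S : Set ℝ} {s : ℝ} (hs : s ∈ S) :
    Tendsto (fun i => (i, s)) l (l ×ˢ 𝓟 S) :=
  tendsto_id.prodMk (tendsto_principal.2 (Eventually.of_forall fun _ => hs))

lemma isBigO_inv_sub_one {f e : ι → ℝ} (h : (fun q => f q - 1) =O[l] e)
    (he : Tendsto e l (𝓝 0)) : (fun q => (f q)⁻¹ - 1) =O[l] e := by
  have hf : Tendsto f l (𝓝 1) := by simpa using (h.trans_tendsto he).add_const 1
  have hi : (fun q => (f q)⁻¹) =O[l] fun _ => (1 : ℝ) := (hf.inv₀ one_ne_zero).isBigO_one ℝ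
  have := (h.neg_left).mul hi
  simp only [mul_one] at this
  refine this.congr' ?_ EventuallyEq.rfl
  filter_upwards [hf.eventually_ne one_ne_zero] with q hq
  field_simp
  ring

end Tools

/-- A family of light rays from `xA` to `xB`, the mass parameter tending to zero. -/
structure RayFamily {ι : Type*} (l : Filter ι) (ρ g κ : ℝ) (fA fC : ℝ → ℝ) (m : ι → ℝ)
    (t : ι → ℝ → ℝ) (x p : ι → ℝ → Triple) (l0 : ι → ℝ) (xA xB : Triple) : Prop where
  profile : IsOpticalProfile ρ g κ fA fC
  tendsto_mass : Tendsto m l (𝓝[>] 0)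
  ray : ∀ᶠ i in l, IsOpticalRay ρ fA fC (m i) (t i) (x i) (p i) (l0 i)
  start : ∀ᶠ i in l, x i 0 = xB
  finish : ∀ᶠ i in l, x i 1 = xA

/-- On `[0, a]` the rays of the family stay away from the centre. -/
def StaysAway {ι : Type*} (l : Filter ι) (x : ι → ℝ → Triple) (a δ : ℝ) : Prop :=
  0 < δ ∧ ∀ᶠ i in l, ∀ s ∈ Icc 0 a, δ ≤ ‖x i s‖

section Family

variable {ι : Type*} {l : Filter ι} {ρ g κ : ℝ} {fA fC : ℝ → ℝ} {m : ι → ℝ}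
  {t : ι → ℝ → ℝ} {x p : ι → ℝ → Triple} {l0 : ι → ℝ} {xA xB : Triple} {a δ : ℝ}

namespace RayFamily

lemma mass_tendsto_zero (F : RayFamily l ρ g κ fA fC m t x p l0 xA xB) :
    Tendsto m l (𝓝 0) := F.tendsto_mass.mono_right nhdsWithin_le_nhds

lemma mass_pos (F : RayFamily l ρ g κ fA fC m t x p l0 xA xB) : ∀ᶠ i in l, 0 < m i :=
  F.tendsto_mass.eventually self_mem_nhdsWithin

lemma mass_tendsto_prod (F : RayFamily l ρ g κ fA fC m t x p l0 xA xB) :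
    Tendsto (fun q : ι × ℝ => m q.1) (l ×ˢ 𝓟 (Icc 0 a)) (𝓝 0) :=
  F.mass_tendsto_zero.comp tendsto_fst

/-- Away from the centre the ratio m/r is O(m) uniformly in the parameter; every weak-field estimate
along the ray is pulled back through this one. -/
lemma ratio_isBigO (hreg : StaysAway l x a δ) :
    (fun q : ι × ℝ => m q.1 / ‖x q.1 q.2‖) =O[l ×ˢ 𝓟 (Icc 0 a)] fun q => m q.1 := by
  refine IsBigO.of_bound δ⁻¹ ?_
  rw [eventually_prod_principal_iff]
  filter_upwards [hreg.2] with i hi s hs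
  have := hi s hs
  have hδ := hreg.1
  rw [norm_div, norm_norm, div_eq_inv_mul]
  gcongr

lemma ratio_tendsto (F : RayFamily l ρ g κ fA fC m t x p l0 xA xB) (hreg : StaysAway l x a δ) :
    Tendsto (fun q : ι × ℝ => m q.1 / ‖x q.1 q.2‖) (l ×ˢ 𝓟 (Icc 0 a)) (𝓝 0) :=
  (ratio_isBigO hreg).trans_tendsto F.mass_tendsto_prod

lemma potentialA_isBigO (F : RayFamily l ρ g κ fA fC m t x p l0 xA xB)
    (hreg : StaysAway l x a δ) :
    (fun q : ι × ℝ => fA (m q.1 / ‖x q.1 q.2‖) - 1) =O[l ×ˢ 𝓟 (Icc 0 a)] fun q => m q.1 :=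
  (F.profile.linA.comp_tendsto (F.ratio_tendsto hreg)).trans (ratio_isBigO hreg)

lemma potentialC_isBigO (F : RayFamily l ρ g κ fA fC m t x p l0 xA xB)
    (hreg : StaysAway l x a δ) :
    (fun q : ι × ℝ => fC (m q.1 / ‖x q.1 q.2‖) - 1) =O[l ×ˢ 𝓟 (Icc 0 a)] fun q => m q.1 :=
  (F.profile.linC.comp_tendsto (F.ratio_tendsto hreg)).trans (ratio_isBigO hreg)

lemma inv_potentialC_isBigO_one (F : RayFamily l ρ g κ fA fC m t x p l0 xA xB)
    (hreg : StaysAway l x a δ) :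
    (fun q : ι × ℝ => (fC (m q.1 / ‖x q.1 q.2‖))⁻¹) =O[l ×ˢ 𝓟 (Icc 0 a)]
      fun _ => (1 : ℝ) := by
  have h := isBigO_inv_sub_one (F.potentialC_isBigO hreg) F.mass_tendsto_prod
  have : Tendsto (fun q : ι × ℝ => (fC (m q.1 / ‖x q.1 q.2‖))⁻¹) (l ×ˢ 𝓟 (Icc 0 a)) (𝓝 1) := by
    simpa using (h.trans_tendsto F.mass_tendsto_prod).add_const 1
  exact this.isBigO_one ℝ

lemma index_tendsto_one (F : RayFamily l ρ g κ fA fC m t x p l0 xA xB)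
    (hreg : StaysAway l x a δ) :
    Tendsto (fun q : ι × ℝ => fC (m q.1 / ‖x q.1 q.2‖) / fA (m q.1 / ‖x q.1 q.2‖))
      (l ×ˢ 𝓟 (Icc 0 a)) (𝓝 1) := by
  have hA := ((F.potentialA_isBigO hreg).trans_tendsto F.mass_tendsto_prod).add_const 1
  have hC := ((F.potentialC_isBigO hreg).trans_tendsto F.mass_tendsto_prod).add_const 1
  simp only [sub_add_cancel, zero_add] at hA hC
  rw [← div_one (1 : ℝ)]
  exact hC.div hA one_ne_zero

lemma direction_isBigO_one (F : RayFamily l ρ g κ fA fC m t x p l0 xA xB) (ha : a ≤ 1)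
    (hreg : StaysAway l x a δ) :
    (fun q : ι × ℝ => p q.1 q.2) =O[l ×ˢ 𝓟 (Icc 0 a)] fun _ => (1 : ℝ) := by
  refine IsBigO.of_bound 2 ?_
  have h := (F.index_tendsto_one hreg).eventually_le_const (u := 4) (by norm_num)
  rw [eventually_prod_principal_iff] at h ⊢
  filter_upwards [h, F.ray] with i hi hr s hs
  have h1 := hi s hs
  rw [← hr.energy s (Icc_subset_Icc_right ha hs)] at h1
  rw [norm_one, mul_one]
  nlinarith [norm_nonneg (p i s)]

lemma derivIndex_isBigO_one (F : RayFamily l ρ g κ fA fC m t x p l0 xA xB)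
    (hreg : StaysAway l x a δ) :
    (fun q : ι × ℝ => deriv (fun z => fC z / fA z) (m q.1 / ‖x q.1 q.2‖)) =O[l ×ˢ 𝓟 (Icc 0 a)]
      fun _ => (1 : ℝ) := by
  have hy := F.ratio_tendsto hreg
  have h1 := (F.profile.derivIndex.comp_tendsto hy).trans_tendsto
    (show Tendsto (fun q : ι × ℝ => (m q.1 / ‖x q.1 q.2‖) ^ 2) _ (𝓝 (0 : ℝ)) by
      simpa using hy.pow 2)
  have h2 : Tendsto (fun q : ι × ℝ => 2 * g + 4 * κ * (m q.1 / ‖x q.1 q.2‖))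
      (l ×ˢ 𝓟 (Icc 0 a)) (𝓝 (2 * g)) := by
    simpa using (hy.const_mul (4 * κ)).const_add (2 * g)
  have h3 := h1.add h2
  simp only [Function.comp_def, sub_add_cancel] at h3
  exact h3.isBigO_one ℝ

/-- The force is m/r² times a bounded factor. A bound on l₀ is required because l₀ sets the rate at
which the parameter runs along the ray. -/
lemma direction_sub_isBigO (F : RayFamily l ρ g κ fA fC m t x p l0 xA xB) (ha : a ∈ Icc (0 : ℝ) 1)
    (hreg : StaysAway l x a δ) (hl : l0 =O[l] fun _ => (1 : ℝ)) :
    (fun q : ι × ℝ => p q.1 q.2 - p q.1 0) =O[l ×ˢ 𝓟 (Icc 0 a)] fun q => m q.1 := by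
  refine isBigO_sub_of_hasDerivWithinAt ha.1 (G' := fun i s => (-l0 i / fC (m i / ‖x i s‖)) •
      (-(1 / 2 * deriv (fun z => fC z / fA z) (m i / ‖x i s‖) * m i / ‖x i s‖ ^ 3)) • x i s) ?_ ?_
  · filter_upwards [F.ray] with i hi s hs
    exact (hi.momentum s (Icc_subset_Icc_right ha.2 hs)).mono (Icc_subset_Icc_right ha.2)
  · have h1 : (fun q : ι × ℝ => (m q.1 / ‖x q.1 q.2‖ ^ 3) • x q.1 q.2) =O[l ×ˢ 𝓟 (Icc 0 a)]
        fun q => m q.1 := by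
      refine IsBigO.of_bound ((δ ^ 2)⁻¹) ?_
      rw [eventually_prod_principal_iff]
      filter_upwards [hreg.2] with i hi s hs
      have h := hi s hs
      have hδ := hreg.1
      have hx : 0 < ‖x i s‖ := hδ.trans_le h
      rw [norm_smul, norm_div, norm_pow, norm_norm,
        show ‖m i‖ / ‖x i s‖ ^ 3 * ‖x i s‖ = (‖x i s‖ ^ 2)⁻¹ * ‖m i‖ by field_simp]
      gcongr
    have h2 : (fun q : ι × ℝ => l0 q.1) =O[l ×ˢ 𝓟 (Icc 0 a)] fun _ => (1 : ℝ) :=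
      hl.comp_tendsto tendsto_fst
    have h3 := ((h2.neg_left.mul (F.inv_potentialC_isBigO_one hreg)).mul
      ((F.derivIndex_isBigO_one hreg).const_mul_left (-(1 / 2)))).smul h1
    simp only [mul_one, one_smul] at h3
    refine h3.congr_left fun q => ?_
    rw [smul_smul, smul_smul]
    congr 1
    ring

/-- The comparison line has the actual initial direction p(0), since nothing relates p(0) to N at
this stage. -/
lemma position_isBigO (F : RayFamily l ρ g κ fA fC m t x p l0 xA xB) (ha : a ∈ Icc (0 : ℝ) 1)
    (hreg : StaysAway l x a δ) (hl : l0 =O[l] fun _ => (1 : ℝ)) :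
    (fun q : ι × ℝ => x q.1 q.2 - x q.1 0 + (l0 q.1 * q.2) • p q.1 0) =O[l ×ˢ 𝓟 (Icc 0 a)]
      fun q => m q.1 := by
  have h := isBigO_sub_of_hasDerivWithinAt (l := l) (e := m) ha.1
    (G := fun i s => x i s + (l0 i * s) • p i 0)
    (G' := fun i s => (-l0 i / fC (m i / ‖x i s‖)) • p i s + l0 i • p i 0) ?_ ?_
  · refine h.congr_left fun q => ?_
    simp only [mul_zero, zero_smul, add_zero]
    abel
  · filter_upwards [F.ray] with i hi s hs
    have h1 := (hi.position s (Icc_subset_Icc_right ha.2 hs)).mono (Icc_subset_Icc_right ha.2)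
    have h2 := ((hasDerivWithinAt_id s (Icc 0 a)).const_mul (l0 i)).smul_const (p i 0)
    refine (h1.add h2).congr_deriv ?_
    simp
  · have h2 : (fun q : ι × ℝ => l0 q.1) =O[l ×ˢ 𝓟 (Icc 0 a)] fun _ => (1 : ℝ) :=
      hl.comp_tendsto tendsto_fst
    have h3 := (h2.mul (isBigO_inv_sub_one (F.potentialC_isBigO hreg) F.mass_tendsto_prod)).smul
      (F.direction_isBigO_one ha.2 hreg)
    have h4 := h2.smul (F.direction_sub_isBigO ha hreg hl)
    simp only [one_mul, smul_eq_mul, mul_one] at h3 h4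
    refine (h3.add h4).neg_left.congr_left fun q => ?_
    rw [div_eq_mul_inv]
    module

/-- The error is measured relative to l₀: this estimate is used to find the limit of l₀, before any
bound on it is available. -/
lemma time_isBigO (F : RayFamily l ρ g κ fA fC m t x p l0 xA xB) (ha : a ∈ Icc (0 : ℝ) 1)
    (hreg : StaysAway l x a δ) :
    (fun q : ι × ℝ => t q.1 q.2 - t q.1 0 - l0 q.1 * q.2) =O[l ×ˢ 𝓟 (Icc 0 a)]
      fun q => l0 q.1 * m q.1 := by
  have h := isBigO_sub_of_hasDerivWithinAt (l := l) (e := fun i => l0 i * m i) ha.1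
    (G := fun i s => t i s - l0 i * s)
    (G' := fun i s => l0 i / fA (m i / ‖x i s‖) - l0 i) ?_ ?_
  · refine h.congr_left fun q => ?_
    ring
  · filter_upwards [F.ray] with i hi s hs
    have h1 := (hi.time s (Icc_subset_Icc_right ha.2 hs)).mono (Icc_subset_Icc_right ha.2)
    have h2 := ((hasDerivWithinAt_id s (Icc 0 a)).const_mul (l0 i))
    exact (h1.sub h2).congr_deriv (by simp)
  · have h3 := (isBigO_refl (fun q : ι × ℝ => l0 q.1) (l ×ˢ 𝓟 (Icc 0 a))).mul
      (isBigO_inv_sub_one (F.potentialA_isBigO hreg) F.mass_tendsto_prod)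
    refine h3.congr_left fun q => ?_
    rw [div_eq_mul_inv]; ring

end RayFamily

end Family

/-! ### Confinement of the rays -/

/-- A first hitting time. The strict inequality before it is what makes the weak-field bounds
available up to that time in the continuation argument. -/
lemma exists_first_le {f : ℝ → ℝ} {a δ s : ℝ} (hf : ContinuousOn f (Icc 0 a)) (hs : s ∈ Icc 0 a)
    (h : f s ≤ δ) : ∃ s₁ ∈ Icc 0 a, f s₁ ≤ δ ∧ ∀ s ∈ Ico 0 s₁, δ < f s := by
  have hc : IsClosed (Icc 0 a ∩ f ⁻¹' Iic δ) := hf.preimage_isClosed_of_isClosed isClosed_Icc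
    isClosed_Iic
  obtain ⟨s₁, hs₁, hmin⟩ := (isCompact_Icc.of_isClosed_subset hc inter_subset_left).exists_isLeast
    ⟨s, hs, h⟩
  refine ⟨s₁, hs₁.1, hs₁.2, fun z hz => ?_⟩
  by_contra hcon
  exact absurd (hmin ⟨⟨hz.1, hz.2.le.trans hs₁.1.2⟩, not_lt.1 hcon⟩) (not_le.2 hz.2)

namespace IsOpticalRay

variable {ρ g κ m l0 : ℝ} {fA fC : ℝ → ℝ} {t : ℝ → ℝ} {x p : ℝ → Triple}

lemma continuousOn_position (h : IsOpticalRay ρ fA fC m t x p l0) :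
    ContinuousOn x (Icc 0 1) := fun s hs => (h.position s hs).continuousWithinAt

lemma antitoneOn_time (h : IsOpticalRay ρ fA fC m t x p l0) (hf : IsOpticalProfile ρ g κ fA fC) :
    AntitoneOn t (Icc 0 1) := by
  refine antitoneOn_of_hasDerivWithinAt_nonpos (convex_Icc 0 1)
    (f' := fun s => l0 / fA (m / ‖x s‖)) (fun s hs => (h.time s hs).continuousWithinAt)
    (fun s hs => (h.time s (interior_subset hs)).mono interior_subset) ?_
  intro s hs
  exact div_nonpos_of_nonpos_of_nonneg h.neg.le
    (hf.posA _ (h.exterior s (interior_subset hs))).le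

/-- The distance covered is at most twice the elapsed time, where the metric is nearly flat. -/
lemma norm_sub_le (h : IsOpticalRay ρ fA fC m t x p l0) (hf : IsOpticalProfile ρ g κ fA fC)
    {s₁ : ℝ} (hs₁ : s₁ ∈ Icc (0 : ℝ) 1)
    (hflat : ∀ s ∈ Ico 0 s₁, fA (m / ‖x s‖) ≤ 4 * fC (m / ‖x s‖)) :
    ‖x s₁ - x 0‖ ≤ 2 * (t 0 - t s₁) := by
  have hsub : Icc 0 s₁ ⊆ Icc (0 : ℝ) 1 := Icc_subset_Icc_right hs₁.2
  have hnhds : ∀ s ∈ Ico 0 s₁, Icc (0 : ℝ) 1 ∈ 𝓝[≥] s := fun s hs =>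
    mem_of_superset (Icc_mem_nhdsGE (hs.2.trans_le hs₁.2)) (Icc_subset_Icc_left hs.1)
  have hmem : ∀ s ∈ Ico 0 s₁, s ∈ Icc (0 : ℝ) 1 := fun s hs => hsub ⟨hs.1, hs.2.le⟩
  refine image_norm_le_of_norm_deriv_right_le_deriv_boundary' (f := fun s => x s - x 0)
    (f' := fun s => (-l0 / fC (m / ‖x s‖)) • p s) (B := fun s => 2 * (t 0 - t s))
    (B' := fun s => 2 * (-(l0 / fA (m / ‖x s‖)))) ((h.continuousOn_position.mono hsub).sub
      continuousOn_const) ?_ (by simp) ?_ ?_ ?_ (right_mem_Icc.2 hs₁.1)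
  · intro s hs
    exact ((h.position s (hmem s hs)).sub_const _).mono_of_mem_nhdsWithin (hnhds s hs)
  · intro s hs
    exact (((h.time s (hsub hs)).continuousWithinAt.mono hsub).const_sub (t 0)).const_mul 2
  · intro s hs
    exact (((h.time s (hmem s hs)).mono_of_mem_nhdsWithin (hnhds s hs)).const_sub (t 0)).const_mul 2
  · intro s hs
    have hA := hf.posA _ (h.exterior s (hmem s hs))
    have hC := hf.posC _ (h.exterior s (hmem s hs))
    have hl := h.neg
    set A := fA (m / ‖x s‖)
    set C := fC (m / ‖x s‖)
    -- As |p|² = C/A, this bound is equivalent to A ≤ 4C. It says that the coordinate speed, which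
    -- is √(A/C), is at most 2.
    have hn : ‖p s‖ ≤ 2 * C / A := by
      refine abs_le_of_sq_le_sq' ?_ (by positivity) |>.2
      rw [h.energy s (hmem s hs), div_pow, div_le_div_iff₀ hA (by positivity)]
      have := hflat s hs
      nlinarith [mul_pos hA hC, mul_pos (mul_pos hA hC) hA,
        mul_nonneg (mul_pos hA hC).le (sub_nonneg.2 this)]
    rw [norm_smul, Real.norm_of_nonneg (div_nonneg (neg_nonneg.2 hl.le) hC.le)]
    calc -l0 / C * ‖p s‖ ≤ -l0 / C * (2 * C / A) := by
          have : 0 ≤ -l0 / C := div_nonneg (neg_nonneg.2 hl.le) hC.le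
          gcongr
      _ = 2 * -(l0 / A) := by field_simp

/-- Conservation of angular momentum. -/
lemma cross_eq (h : IsOpticalRay ρ fA fC m t x p l0) {s : ℝ} (hs : s ∈ Icc (0 : ℝ) 1) :
    cross (x s) (p s) = cross (x 0) (p 0) := by
  have hd : ∀ s ∈ Icc (0 : ℝ) 1,
      HasDerivWithinAt (fun s => cross (x s) (p s)) 0 (Icc 0 1) s := fun s hs => by
    refine (hasDerivWithinAt_cross (h.position s hs) (h.momentum s hs)).congr_deriv ?_
    -- The force is central and the velocity is parallel to p, so both cross products vanish.
    simp only [cross_smul_left, cross_smul_right, cross_self_eq_zero, smul_zero, add_zero]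
  have := (convex_Icc (0 : ℝ) 1).norm_image_sub_le_of_norm_hasDerivWithin_le (C := 0) hd
    (fun x _ => by simp) (left_mem_Icc.2 zero_le_one) hs
  simpa [sub_eq_zero] using this

end IsOpticalRay

section Family

variable {ι : Type*} {l : Filter ι} {ρ g κ : ℝ} {fA fC : ℝ → ℝ} {m : ι → ℝ}
  {t : ι → ℝ → ℝ} {x p : ι → ℝ → Triple} {l0 : ι → ℝ} {xA xB : Triple} {a δ : ℝ}

lemma IsOpticalProfile.tendstoA (hf : IsOpticalProfile ρ g κ fA fC) :
    Tendsto fA (𝓝 0) (𝓝 1) := by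
  simpa using (hf.linA.trans_tendsto tendsto_id).add_const 1

lemma IsOpticalProfile.tendstoC (hf : IsOpticalProfile ρ g κ fA fC) :
    Tendsto fC (𝓝 0) (𝓝 1) := by
  simpa using (hf.linC.trans_tendsto tendsto_id).add_const 1

namespace RayFamily

/-- Properties of the weak-field regime hold at all points with `r ≥ δ`. -/
lemma eventually_weak (F : RayFamily l ρ g κ fA fC m t x p l0 xA xB) {P : ℝ → Prop}
    (hP : ∀ᶠ y in 𝓝 0, P y) (hδ : 0 < δ) : ∀ᶠ i in l, ∀ r, δ ≤ r → P (m i / r) := by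
  obtain ⟨η, hη, hball⟩ := Metric.eventually_nhds_iff.1 hP
  have h1 : Tendsto (fun i => m i / δ) l (𝓝 0) := by simpa using F.mass_tendsto_zero.div_const δ
  filter_upwards [h1.eventually_lt_const hη, F.mass_pos] with i hi hm r hr
  refine hball ?_
  have hr0 : 0 < r := hδ.trans_le hr
  rw [Real.dist_0_eq_abs, abs_of_pos (div_pos hm hr0)]
  refine lt_of_le_of_lt ?_ hi
  gcongr

/-- Before the ray first comes within δ of the centre its speed is at most 2, and the time elapsed
up to `s₀` is too short for it to travel that far from x_B. -/
lemma staysAway_initial (F : RayFamily l ρ g κ fA fC m t x p l0 xA xB) {s₀ : ℝ}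
    (hs₀ : s₀ ∈ Ioc (0 : ℝ) 1) (hsmall : s₀ * ‖xB - xA‖ ≤ ‖xB‖ / 4)
    (ht : Tendsto (fun i => t i s₀ - t i 0) l (𝓝 (-(s₀ * ‖xB - xA‖))))
    (hδ : 0 < δ) (hδB : δ ≤ ‖xB‖ / 4) : StaysAway l x s₀ δ := by
  refine ⟨hδ, ?_⟩
  have hweak := F.eventually_weak (δ := δ)
    ((F.profile.tendstoA.eventually_le_const (u := 2) (by norm_num)).and
      (F.profile.tendstoC.eventually_const_le (u := 1 / 2) (by norm_num))) hδ
  -- The elapsed time tends to at most ‖x_B‖/4, hence is eventually below ‖x_B‖/3. The displacement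
  -- is then below 2‖x_B‖/3, so r > ‖x_B‖/3, which exceeds δ ≤ ‖x_B‖/4.
  have ht' := ht.eventually_const_lt (u := -(‖xB‖ / 3)) (by linarith)
  filter_upwards [hweak, ht', F.ray, F.start] with i hi hti hr hst s hs
  by_contra hcon
  push Not at hcon
  have hsub : Icc 0 s₀ ⊆ Icc (0 : ℝ) 1 := Icc_subset_Icc_right hs₀.2
  obtain ⟨s₁, hs₁, hle, hlt⟩ := exists_first_le (f := fun s => ‖x i s‖)
    (hr.continuousOn_position.mono hsub).norm hs hcon.le
  have h1 := hr.norm_sub_le F.profile (hsub hs₁) fun z hz => by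
    have := hi _ (hlt z hz).le
    linarith [this.1, this.2]
  have h2 := hr.antitoneOn_time F.profile (hsub hs₁) (hsub (right_mem_Icc.2 hs₀.1.le)) hs₁.2
  rw [hst, norm_sub_rev] at h1
  have h3 := norm_sub_norm_le xB (x i s₁)
  have hle' : ‖x i s₁‖ ≤ δ := hle
  linarith

lemma tendsto_energy (F : RayFamily l ρ g κ fA fC m t x p l0 xA xB) {s₀ : ℝ}
    (hs₀ : s₀ ∈ Ioc (0 : ℝ) 1)
    (ht : Tendsto (fun i => t i s₀ - t i 0) l (𝓝 (-(s₀ * ‖xB - xA‖))))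
    (hreg : StaysAway l x s₀ δ) : Tendsto l0 l (𝓝 (-‖xB - xA‖)) := by
  have h := (F.time_isBigO ⟨hs₀.1.le, hs₀.2⟩ hreg).comp_tendsto
    (tendsto_prodMk_principal (l := l) (right_mem_Icc.2 hs₀.1.le))
  -- The error l₀O(m) is small relative to l₀s₀ whatever the size of l₀, so asymptotic equivalence
  -- transfers the limit of the elapsed time to l₀s₀.
  have h2 : (fun i => l0 i * m i) =o[l] fun i => l0 i * s₀ := by
    refine (isBigO_refl l0 l).mul_isLittleO ?_
    exact (isLittleO_const_iff hs₀.1.ne').2 F.mass_tendsto_zero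
  have h3 : Asymptotics.IsEquivalent l (fun i => t i s₀ - t i 0) fun i => l0 i * s₀ :=
    h.trans_isLittleO h2
  have h4 := (h3.tendsto_nhds ht).div_const s₀
  have hs := hs₀.1.ne'
  refine (h4.congr fun i => ?_).trans_eq ?_
  · field_simp
  · congr 1; field_simp

/-- The displacement up to `s₀` is −l₀s₀p(0) + O(m), and the limits of the displacement and of l₀
are both known. -/
lemma tendsto_direction (F : RayFamily l ρ g κ fA fC m t x p l0 xA xB) {s₀ : ℝ}
    (hs₀ : s₀ ∈ Ioc (0 : ℝ) 1) (hne : xB - xA ≠ 0)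
    (ht : Tendsto (fun i => t i s₀ - t i 0) l (𝓝 (-(s₀ * ‖xB - xA‖))))
    (hx : Tendsto (fun i => x i s₀) l (𝓝 (xB - s₀ • (xB - xA))))
    (hreg : StaysAway l x s₀ δ) : Tendsto (fun i => p i 0) l (𝓝 (-vecN xA xB)) := by
  have hl := F.tendsto_energy hs₀ ht hreg
  have h := ((F.position_isBigO ⟨hs₀.1.le, hs₀.2⟩ hreg (hl.isBigO_one ℝ)).comp_tendsto
    (tendsto_prodMk_principal (l := l) (right_mem_Icc.2 hs₀.1.le))).trans_tendsto
      F.mass_tendsto_zero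
  have hR : ‖xB - xA‖ ≠ 0 := norm_ne_zero_iff.2 hne
  have hs := hs₀.1.ne'
  have hls : Tendsto (fun i => l0 i * s₀) l (𝓝 (-‖xB - xA‖ * s₀)) := hl.mul_const s₀
  have hne0 : -‖xB - xA‖ * s₀ ≠ 0 := mul_ne_zero (neg_ne_zero.2 hR) hs
  have h1 := (hls.inv₀ hne0).smul (h.sub (hx.sub_const xB))
  have h2 : (-‖xB - xA‖ * s₀)⁻¹ • ((0 : Triple) - (xB - s₀ • (xB - xA) - xB)) = -vecN xA xB := by
    rw [show (0 : Triple) - (xB - s₀ • (xB - xA) - xB) = s₀ • (xB - xA) by abel, smul_smul, vecN,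
      unit, ← neg_smul]
    congr 1
    field_simp
  rw [h2] at h1
  refine h1.congr' ?_
  filter_upwards [hls.eventually_ne hne0, F.start] with i hi hst
  simp only [Function.comp_def, hst]
  rw [show x i s₀ - xB + (l0 i * s₀) • p i 0 - (x i s₀ - xB) = (l0 i * s₀) • p i 0 by abel,
    smul_smul, inv_mul_cancel₀ hi, one_smul]

/-- A ray reaching radius r_c/4 would have angular momentum at most (r_c/4)|p| ≤ r_c/2 there, while
the conserved value, computed at x_B from the limiting direction −N, tends to r_c. -/
lemma staysAway (F : RayFamily l ρ g κ fA fC m t x p l0 xA xB) (hx : cross xA xB ≠ 0)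
    (hp : Tendsto (fun i => p i 0) l (𝓝 (-vecN xA xB))) :
    StaysAway l x 1 (closestApproach xA xB / 4) := by
  have hrc := closestApproach_pos hx
  refine ⟨by positivity, ?_⟩
  have hb : Tendsto (fun i => dot (-cross xB (p i 0)) (vecQ xA xB)) l
      (𝓝 (closestApproach xA xB)) := by
    simp only [dot_neg_cross_vecQ hx]
    have hc : ∀ w : Triple, Tendsto (fun i => dot (p i 0) w) l (𝓝 (dot (-vecN xA xB) w)) :=
      fun w => hp.inner tendsto_const_nhds
    have hN : dot (-vecN xA xB) (vecN xA xB) = -1 := by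
      rw [← neg_one_smul ℝ, dot_smul_left, dot_vecN_self hx]; norm_num
    have hP : dot (-vecN xA xB) (vecP xA xB) = 0 := by
      rw [← neg_one_smul ℝ, dot_smul_left, dot_vecN_vecP]; norm_num
    have := ((hc (vecP xA xB)).const_mul (dot xB (vecN xA xB))).sub
      ((hc (vecN xA xB)).const_mul (dot xB (vecP xA xB)))
    rw [hN, hP, dot_right_vecP hx] at this
    simpa [dot_right_vecP hx] using this
  have hidx := F.profile.tendstoC.div F.profile.tendstoA one_ne_zero
  have hweak := F.eventually_weak (δ := closestApproach xA xB / 4)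
    (hidx.eventually_le_const (u := 4) (by norm_num)) (by positivity)
  filter_upwards [hweak, hb.eventually_const_lt (half_lt_self hrc), F.ray, F.start]
    with i hi hbi hr hst s hs
  by_contra hcon
  push Not at hcon
  have hcB : closestApproach xA xB ≤ ‖xB‖ := by
    refine abs_le_of_sq_le_sq' ?_ (norm_nonneg _) |>.2
    rw [norm_sq_right hx]; nlinarith [sq_nonneg (dot xB (vecN xA xB))]
  -- The ray starts at ‖x_B‖ ≥ r_c, so it crosses radius r_c/4 exactly. The weak-field bound |p| ≤ 2
  -- holds at that point, though it may fail deeper inside.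
  obtain ⟨s₁, hs₁, heq⟩ : ∃ s₁ ∈ Icc 0 s, ‖x i s₁‖ = closestApproach xA xB / 4 := by
    refine intermediate_value_Icc' hs.1
      (hr.continuousOn_position.mono (Icc_subset_Icc_right hs.2)).norm ⟨hcon.le, ?_⟩
    simp only [hst]; linarith
  have hs₁' : s₁ ∈ Icc (0 : ℝ) 1 := ⟨hs₁.1, hs₁.2.trans hs.2⟩
  have h1 := hr.cross_eq hs₁'
  rw [hst] at h1
  rw [← h1] at hbi
  have h2 : ‖p i s₁‖ ≤ 2 := by
    have h4 := hi _ heq.ge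
    simp only [Pi.div_apply] at h4
    rw [← hr.energy s₁ hs₁'] at h4
    nlinarith [norm_nonneg (p i s₁)]
  have h3 : dot (-cross (x i s₁) (p i s₁)) (vecQ xA xB) ≤ ‖x i s₁‖ * ‖p i s₁‖ := by
    have hQ : ‖vecQ xA xB‖ = 1 := by
      have := dot_vecQ_self hx
      rw [← norm_sq_eq_dot] at this
      nlinarith [norm_nonneg (vecQ xA xB)]
    refine (real_inner_le_norm _ _).trans ?_
    rw [norm_neg, hQ, mul_one]
    exact norm_cross_le _ _
  rw [heq] at h3
  nlinarith

end RayFamily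

end Family

/-! ### Planar coordinates and first-order estimates -/

/-- The conserved angular momentum is directed along `Q`. -/
lemma IsOpticalRay.neg_cross_eq {ρ m l0 : ℝ} {fA fC : ℝ → ℝ} {t : ℝ → ℝ} {x p : ℝ → Triple}
    {xA xB : Triple} (h : IsOpticalRay ρ fA fC m t x p l0) (hx : cross xA xB ≠ 0)
    (h0 : x 0 = xB) (h1 : x 1 = xA) {s : ℝ} (hs : s ∈ Icc (0 : ℝ) 1) :
    -cross (x s) (p s) = dot (-cross xB (p 0)) (vecQ xA xB) • vecQ xA xB := by
  rw [h.cross_eq hs, h0]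
  have e1 := h.cross_eq (right_mem_Icc.2 zero_le_one)
  rw [h0, h1] at e1
  -- Equality of the conserved vector at the two ends makes it orthogonal to both x_A and x_B, hence
  -- to N and P.
  set c := cross xB (p 0) with hc
  have cB : dot xB c = 0 := dot_cross_left _ _
  have cA : dot xA c = 0 := by rw [← e1]; exact dot_cross_left _ _
  have cN : dot (-c) (vecN xA xB) = 0 := by
    rw [← neg_one_smul ℝ, dot_smul_left, dot_comm, vecN, unit, dot_smul_left, dot_sub_left, cA, cB]
    simp
  have cP : dot (-c) (vecP xA xB) = 0 := by
    have h2 := eq_of_dot_vecQ_eq_zero hx (dot_right_vecQ hx)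
    rw [h2, dot_add_left, dot_smul_left, dot_smul_left, dot_right_vecP hx] at cB
    rw [← neg_one_smul ℝ, dot_smul_left, dot_comm] at cN
    have h3 : dot (vecN xA xB) c = 0 := by linarith
    rw [h3, mul_zero, zero_add] at cB
    have h4 := (mul_eq_zero.1 cB).resolve_left (closestApproach_pos hx).ne'
    rw [← neg_one_smul ℝ, dot_smul_left, dot_comm, h4, mul_zero]
  have := eq_of_orthonormal (dot_vecN_self hx) (dot_vecQ_self hx) (dot_vecN_vecQ hx) (-c)
  rw [cN, ← vecP, cP] at this
  simpa using this

section Family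

variable {ι : Type*} {l : Filter ι} {ρ g κ : ℝ} {fA fC : ℝ → ℝ} {m : ι → ℝ}
  {t : ι → ℝ → ℝ} {x p : ι → ℝ → Triple} {l0 : ι → ℝ} {xA xB : Triple} {a δ : ℝ}

lemma isBigO_dot {τ : Type*} {L : Filter τ} {f : τ → Triple} {e : τ → ℝ} (h : f =O[L] e)
    (w : Triple) : (fun q => dot (f q) w) =O[L] e := by
  refine IsBigO.trans (IsBigO.of_bound ‖w‖ (Eventually.of_forall fun q => ?_)) h
  rw [mul_comm]
  exact norm_inner_le_norm _ _

namespace RayFamily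

lemma index_sub_one_isBigO (F : RayFamily l ρ g κ fA fC m t x p l0 xA xB)
    (hreg : StaysAway l x a δ) :
    (fun q : ι × ℝ => fC (m q.1 / ‖x q.1 q.2‖) / fA (m q.1 / ‖x q.1 q.2‖) - 1)
      =O[l ×ˢ 𝓟 (Icc 0 a)] fun q => m q.1 := by
  have hA := F.potentialA_isBigO hreg
  have hC := F.potentialC_isBigO hreg
  have hA' : Tendsto (fun q : ι × ℝ => fA (m q.1 / ‖x q.1 q.2‖)) (l ×ˢ 𝓟 (Icc 0 a)) (𝓝 1) := by
    simpa using (hA.trans_tendsto F.mass_tendsto_prod).add_const 1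
  have := (hC.sub hA).mul ((hA'.inv₀ one_ne_zero).isBigO_one ℝ)
  simp only [mul_one] at this
  refine this.congr' ?_ EventuallyEq.rfl
  filter_upwards [hA'.eventually_ne one_ne_zero] with q hq
  field_simp
  ring

/-- To lowest order all the rays are straight. -/
lemma direction_add_vecN_isBigO (F : RayFamily l ρ g κ fA fC m t x p l0 xA xB)
    (hne : xB - xA ≠ 0) (hreg : StaysAway l x 1 δ) (hl : Tendsto l0 l (𝓝 (-‖xB - xA‖))) :
    (fun q : ι × ℝ => p q.1 q.2 + vecN xA xB) =O[l ×ˢ 𝓟 (Icc 0 1)] fun q => m q.1 := by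
  have h01 : (1 : ℝ) ∈ Icc (0 : ℝ) 1 := right_mem_Icc.2 zero_le_one
  have hR : ‖xB - xA‖ ≠ 0 := norm_ne_zero_iff.2 hne
  have hRN : ‖xB - xA‖ • vecN xA xB = xB - xA := by
    rw [vecN, unit, smul_smul, mul_inv_cancel₀ hR, one_smul]
  have hl1 : l0 =O[l] fun _ => (1 : ℝ) := hl.isBigO_one ℝ
  -- Convergence alone gives no rate. The rate O(m) comes from the right end point being reached
  -- exactly, together with |p(0)| = 1 + O(m) from the energy identity: lengths give l₀, and then
  -- vectors give p(0).
  have hpos : (fun i => xA - xB + l0 i • p i 0) =O[l] m := by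
    refine ((F.position_isBigO h01 hreg hl1).comp_tendsto
      (tendsto_prodMk_principal (l := l) h01)).congr' ?_ EventuallyEq.rfl
    filter_upwards [F.start, F.finish] with i h0 h1
    simp [h0, h1]
  have hidx : (fun i => ‖p i 0‖ - 1) =O[l] m := by
    have h := (F.index_sub_one_isBigO hreg).comp_tendsto
      (tendsto_prodMk_principal (l := l) (left_mem_Icc.2 zero_le_one))
    refine IsBigO.trans (IsBigO.of_bound 1 ?_) h
    filter_upwards [F.ray] with i hi
    have he := hi.energy 0 (left_mem_Icc.2 zero_le_one)
    simp only [Function.comp_def]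
    rw [← he, one_mul, show ‖p i 0‖ ^ 2 - 1 = (‖p i 0‖ - 1) * (‖p i 0‖ + 1) by ring, norm_mul]
    refine le_mul_of_one_le_right (norm_nonneg _) ?_
    rw [Real.norm_of_nonneg (by positivity)]
    linarith [norm_nonneg (p i 0)]
  have hl2 : (fun i => l0 i + ‖xB - xA‖) =O[l] m := by
    have h1 : (fun i => -l0 i * ‖p i 0‖ - ‖xB - xA‖) =O[l] m := by
      refine IsBigO.trans (IsBigO.of_bound 1 ?_) hpos
      filter_upwards [F.ray] with i hi
      rw [one_mul, show -l0 i * ‖p i 0‖ = ‖l0 i • p i 0‖ by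
        rw [norm_smul, Real.norm_of_nonpos hi.neg.le]]
      refine (abs_norm_sub_norm_le _ _).trans (le_of_eq ?_)
      congr 1; abel
    have h2 : (fun i => l0 i * (‖p i 0‖ - 1) + (-l0 i * ‖p i 0‖ - ‖xB - xA‖)) =O[l] m :=
      IsBigO.add (by simpa using hl1.mul hidx) h1
    refine h2.neg_left.congr_left fun i => ?_
    ring
  have h3 : (fun i => p i 0 + vecN xA xB) =O[l] m := by
    have hinv : (fun i => (l0 i)⁻¹) =O[l] fun _ => (1 : ℝ) :=
      (hl.inv₀ (neg_ne_zero.2 hR)).isBigO_one ℝ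
    have h4 : (fun i => (l0 i + ‖xB - xA‖) • vecN xA xB) =O[l] m := by
      simpa using hl2.smul (isBigO_refl (fun _ : ι => vecN xA xB) l |>.trans
        (isBigO_const_const (vecN xA xB) (one_ne_zero (α := ℝ)) l))
    have h5 := hinv.smul (hpos.add h4)
    simp only [one_smul] at h5
    refine h5.congr' ?_ EventuallyEq.rfl
    filter_upwards [F.ray] with i hi
    have hl0 := hi.neg.ne
    rw [add_smul, hRN, show xA - xB + l0 i • p i 0 + (l0 i • vecN xA xB + (xB - xA))
      = l0 i • (p i 0 + vecN xA xB) by rw [smul_add]; abel, smul_smul, inv_mul_cancel₀ hl0,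
      one_smul]
  have h6 := (F.direction_sub_isBigO h01 hreg hl1).add
    (h3.comp_tendsto (tendsto_fst (g := 𝓟 (Icc (0 : ℝ) 1))))
  refine h6.congr_left fun q => ?_
  simp only [Function.comp_def]
  abel

lemma position_sub_isBigO (F : RayFamily l ρ g κ fA fC m t x p l0 xA xB)
    (hne : xB - xA ≠ 0) (hreg : StaysAway l x 1 δ) (hl : Tendsto l0 l (𝓝 (-‖xB - xA‖))) :
    (fun q : ι × ℝ => x q.1 q.2 - xB - (l0 q.1 * q.2) • vecN xA xB) =O[l ×ˢ 𝓟 (Icc 0 1)]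
      fun q => m q.1 := by
  have h01 : (1 : ℝ) ∈ Icc (0 : ℝ) 1 := right_mem_Icc.2 zero_le_one
  have hl1 : l0 =O[l] fun _ => (1 : ℝ) := hl.isBigO_one ℝ
  have hs : (fun q : ι × ℝ => q.2) =O[l ×ˢ 𝓟 (Icc (0 : ℝ) 1)] fun _ => (1 : ℝ) := by
    refine IsBigO.of_bound 1 ?_
    rw [eventually_prod_principal_iff]
    refine Eventually.of_forall fun i s hs => ?_
    rw [Real.norm_of_nonneg hs.1]; simpa using hs.2
  have hls : (fun q : ι × ℝ => l0 q.1 * q.2) =O[l ×ˢ 𝓟 (Icc (0 : ℝ) 1)] fun _ => (1 : ℝ) := by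
    simpa using (hl1.comp_tendsto tendsto_fst).mul hs
  have hp : (fun q : ι × ℝ => p q.1 0 + vecN xA xB) =O[l ×ˢ 𝓟 (Icc (0 : ℝ) 1)]
      fun q => m q.1 :=
    ((F.direction_add_vecN_isBigO hne hreg hl).comp_tendsto
      (tendsto_prodMk_principal (l := l) (left_mem_Icc.2 zero_le_one))).comp_tendsto tendsto_fst
  have h := (F.position_isBigO h01 hreg hl1).sub (by simpa using hls.smul hp)
  refine h.congr' ?_ EventuallyEq.rfl
  filter_upwards [tendsto_fst.eventually F.start] with q hq
  rw [hq]
  module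

lemma position_isBigO_one (F : RayFamily l ρ g κ fA fC m t x p l0 xA xB)
    (hne : xB - xA ≠ 0) (hreg : StaysAway l x 1 δ) (hl : Tendsto l0 l (𝓝 (-‖xB - xA‖))) :
    (fun q : ι × ℝ => x q.1 q.2) =O[l ×ˢ 𝓟 (Icc 0 1)] fun _ => (1 : ℝ) := by
  have hl1 : (fun q : ι × ℝ => l0 q.1) =O[l ×ˢ 𝓟 (Icc (0 : ℝ) 1)] fun _ => (1 : ℝ) :=
    (hl.isBigO_one ℝ).comp_tendsto tendsto_fst
  have hs : (fun q : ι × ℝ => q.2 • vecN xA xB) =O[l ×ˢ 𝓟 (Icc (0 : ℝ) 1)]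
      fun _ => (1 : ℝ) := by
    refine IsBigO.of_bound ‖vecN xA xB‖ ?_
    rw [eventually_prod_principal_iff]
    refine Eventually.of_forall fun i s hs => ?_
    rw [norm_smul, Real.norm_of_nonneg hs.1, norm_one, mul_one]
    exact mul_le_of_le_one_left (norm_nonneg _) hs.2
  have h1 := (F.position_sub_isBigO hne hreg hl).trans (F.mass_tendsto_prod.isBigO_one ℝ)
  have h2 : (fun _ : ι × ℝ => xB) =O[l ×ˢ 𝓟 (Icc (0 : ℝ) 1)] fun _ => (1 : ℝ) :=
    isBigO_const_const _ one_ne_zero _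
  have h3 := (h1.add h2).add (by simpa using hl1.smul hs)
  refine h3.congr_left fun q => ?_
  module

end RayFamily

end Family

/-! ### The deflection to second order -/

/-- With b = Xv − Yu conserved, the derivative of X/r is exactly −wbY/r³ and that of arctan(X/Y) is
exactly −wb/r². Choosing c₁ = gm/b thus cancels the first-order force −gmY/r³ identically. The c₂
bracket is the primitive of the 1/r⁴ force along the straight line Y = r_c, u = −1, v = 0. -/
lemma hasDerivWithinAt_deflection {X Y v : ℝ → ℝ} {S : Set ℝ} {s w u M c₁ c₂ rc b r : ℝ}
    (hX : HasDerivWithinAt X (w * u) S s) (hY : HasDerivWithinAt Y (w * v s) S s)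
    (hv : HasDerivWithinAt v (w * (-M * Y s)) S s) (hY0 : 0 < Y s)
    (hb : X s * v s - Y s * u = b) (hr0 : 0 < r) (hr : X s ^ 2 + Y s ^ 2 = r ^ 2) :
    HasDerivWithinAt (fun z => v z - c₁ * (X z / √(X z ^ 2 + Y z ^ 2))
        - c₂ * (Real.arctan (X z / Y z) / rc + X z / (X z ^ 2 + Y z ^ 2)))
      (w * (-M * Y s + c₁ * b * Y s / r ^ 3
        - c₂ * (-b / (rc * r ^ 2) + u / r ^ 2 - 2 * X s * (X s * u + Y s * v s) / r ^ 4))) S s := by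
  have hq : HasDerivWithinAt (fun z => X z ^ 2 + Y z ^ 2)
      (2 * w * (X s * u + Y s * v s)) S s := by
    refine ((hX.pow 2).add (hY.pow 2)).congr_deriv ?_
    simp; ring
  have hq0 : X s ^ 2 + Y s ^ 2 ≠ 0 := by rw [hr]; positivity
  have hsq : √(X s ^ 2 + Y s ^ 2) = r := by rw [hr, Real.sqrt_sq hr0.le]
  have h1 := hX.div (hq.sqrt hq0) (by rw [hsq]; exact hr0.ne')
  have h2 := (hX.div hY hY0.ne').arctan
  have h3 := hX.div hq hq0
  refine ((hv.sub (h1.const_mul c₁)).sub (((h2.div_const rc).add h3).const_mul c₂)).congr_deriv ?_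
  rw [hsq, hr]
  have hY1 := hY0.ne'
  have hr1 := hr0.ne'
  have e1 : (w * u * r - X s * (2 * w * (X s * u + Y s * v s) / (2 * r))) / r ^ 2
      = w * (-b * Y s / r ^ 3) := by
    rw [← hb]
    field_simp
    rw [← hr]; ring
  have e2 : 1 / (1 + (X s / Y s) ^ 2) * ((w * u * Y s - X s * (w * v s)) / Y s ^ 2)
      = w * (-b / r ^ 2) := by
    have : 1 + (X s / Y s) ^ 2 = r ^ 2 / Y s ^ 2 := by rw [← hr]; field_simp; ring
    rw [this, ← hb]
    field_simp
    ring
  have e3 : (w * u * r ^ 2 - X s * (2 * w * (X s * u + Y s * v s))) / (r ^ 2) ^ 2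
      = w * (u / r ^ 2 - 2 * X s * (X s * u + Y s * v s) / r ^ 4) := by
    field_simp
  simp only [Pi.div_apply]
  rw [e1, e2, e3]
  ring

section Family

variable {ι : Type*} {l : Filter ι} {ρ g κ : ℝ} {fA fC : ℝ → ℝ} {m : ι → ℝ}
  {t : ι → ℝ → ℝ} {x p : ι → ℝ → Triple} {l0 : ι → ℝ} {xA xB : Triple} {δ : ℝ}

namespace RayFamily

lemma dot_direction_vecN_isBigO (F : RayFamily l ρ g κ fA fC m t x p l0 xA xB)
    (hx : cross xA xB ≠ 0) (hreg : StaysAway l x 1 δ) (hl : Tendsto l0 l (𝓝 (-‖xB - xA‖))) :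
    (fun q : ι × ℝ => dot (p q.1 q.2) (vecN xA xB) + 1) =O[l ×ˢ 𝓟 (Icc 0 1)]
      fun q => m q.1 := by
  refine (isBigO_dot (F.direction_add_vecN_isBigO (sub_ne_zero_of_cross hx) hreg hl)
    (vecN xA xB)).congr_left fun q => ?_
  rw [dot_add_left, dot_vecN_self hx]

lemma dot_direction_vecP_isBigO (F : RayFamily l ρ g κ fA fC m t x p l0 xA xB)
    (hx : cross xA xB ≠ 0) (hreg : StaysAway l x 1 δ) (hl : Tendsto l0 l (𝓝 (-‖xB - xA‖))) :
    (fun q : ι × ℝ => dot (p q.1 q.2) (vecP xA xB)) =O[l ×ˢ 𝓟 (Icc 0 1)] fun q => m q.1 := by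
  refine (isBigO_dot (F.direction_add_vecN_isBigO (sub_ne_zero_of_cross hx) hreg hl)
    (vecP xA xB)).congr_left fun q => ?_
  rw [dot_add_left, dot_vecN_vecP, add_zero]

lemma dot_position_vecP_isBigO (F : RayFamily l ρ g κ fA fC m t x p l0 xA xB)
    (hx : cross xA xB ≠ 0) (hreg : StaysAway l x 1 δ) (hl : Tendsto l0 l (𝓝 (-‖xB - xA‖))) :
    (fun q : ι × ℝ => dot (x q.1 q.2) (vecP xA xB) - closestApproach xA xB)
      =O[l ×ˢ 𝓟 (Icc 0 1)] fun q => m q.1 := by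
  refine (isBigO_dot (F.position_sub_isBigO (sub_ne_zero_of_cross hx) hreg hl)
    (vecP xA xB)).congr_left fun q => ?_
  rw [dot_sub_left, dot_sub_left, dot_smul_left, dot_vecN_vecP, dot_right_vecP hx]
  ring

/-- The impact parameter, evaluated at reception. -/
lemma impact_sub_isBigO (F : RayFamily l ρ g κ fA fC m t x p l0 xA xB)
    (hx : cross xA xB ≠ 0) (hreg : StaysAway l x 1 δ) (hl : Tendsto l0 l (𝓝 (-‖xB - xA‖))) :
    (fun i => dot (-cross xB (p i 0)) (vecQ xA xB) - closestApproach xA xB) =O[l] m := by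
  have h0 := tendsto_prodMk_principal (l := l) (left_mem_Icc.2 (zero_le_one (α := ℝ)))
  have h1 := ((F.dot_direction_vecP_isBigO hx hreg hl).comp_tendsto h0).const_mul_left
    (dot xB (vecN xA xB))
  have h2 := ((F.dot_direction_vecN_isBigO hx hreg hl).comp_tendsto h0).const_mul_left
    (closestApproach xA xB)
  refine (h1.sub h2).congr_left fun i => ?_
  rw [dot_neg_cross_vecQ hx, dot_right_vecP hx]
  simp only [Function.comp_def]
  ring

/-- The second-order change of the transverse component of the direction triple. -/
lemma deflection_isBigO (F : RayFamily l ρ g κ fA fC m t x p l0 xA xB)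
    (hx : cross xA xB ≠ 0) (hreg : StaysAway l x 1 δ) (hl : Tendsto l0 l (𝓝 (-‖xB - xA‖)))
    {b : ι → ℝ} (hb : ∀ᶠ i in l, b i = dot (-cross xB (p i 0)) (vecQ xA xB))
    {tA tB rA rB rc : ℝ} (htA : tA = dot xA (vecN xA xB)) (htB : tB = dot xB (vecN xA xB))
    (hrA : rA = ‖xA‖) (hrB : rB = ‖xB‖) (hrc : rc = closestApproach xA xB) :
    (fun i => dot (p i 1) (vecP xA xB) - dot (p i 0) (vecP xA xB)
      - (g * m i / b i * (tA / rA - tB / rB) + κ * m i ^ 2 / rc *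
        ((Real.arctan (tA / rc) - Real.arctan (tB / rc)) / rc + (tA / rA ^ 2 - tB / rB ^ 2))))
      =O[l] fun i => m i ^ 3 := by
  have hrc0 : 0 < rc := hrc ▸ closestApproach_pos hx
  have hne := sub_ne_zero_of_cross hx
  set X : ι → ℝ → ℝ := fun i s => dot (x i s) (vecN xA xB) with hX
  set Y : ι → ℝ → ℝ := fun i s => dot (x i s) (vecP xA xB) with hY
  set u : ι → ℝ → ℝ := fun i s => dot (p i s) (vecN xA xB) with hu
  set v : ι → ℝ → ℝ := fun i s => dot (p i s) (vecP xA xB) with hv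
  set W : ι → ℝ → ℝ := fun i s => -l0 i / fC (m i / ‖x i s‖) with hW
  set M : ι → ℝ → ℝ := fun i s => 1 / 2 * deriv (fun z => fC z / fA z) (m i / ‖x i s‖) * m i
    / ‖x i s‖ ^ 3 with hM
  -- uniform estimates
  have hmO : (fun q : ι × ℝ => m q.1) =O[l ×ˢ 𝓟 (Icc (0 : ℝ) 1)] fun q => m q.1 := isBigO_refl _ _
  have hη : (fun q : ι × ℝ => Y q.1 q.2 - rc) =O[l ×ˢ 𝓟 (Icc (0 : ℝ) 1)] fun q => m q.1 := by
    rw [hrc]; exact F.dot_position_vecP_isBigO hx hreg hl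
  have hα : (fun q : ι × ℝ => u q.1 q.2 + 1) =O[l ×ˢ 𝓟 (Icc (0 : ℝ) 1)] fun q => m q.1 :=
    F.dot_direction_vecN_isBigO hx hreg hl
  have hvO : (fun q : ι × ℝ => v q.1 q.2) =O[l ×ˢ 𝓟 (Icc (0 : ℝ) 1)] fun q => m q.1 :=
    F.dot_direction_vecP_isBigO hx hreg hl
  have hbl : (fun i => b i - rc) =O[l] m := by
    refine (F.impact_sub_isBigO hx hreg hl).congr' ?_ EventuallyEq.rfl
    filter_upwards [hb] with i hi
    rw [hi, hrc]
  have hbO : (fun q : ι × ℝ => b q.1 - rc) =O[l ×ˢ 𝓟 (Icc (0 : ℝ) 1)] fun q => m q.1 :=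
    hbl.comp_tendsto tendsto_fst
  have hXO : (fun q : ι × ℝ => X q.1 q.2) =O[l ×ˢ 𝓟 (Icc (0 : ℝ) 1)] fun _ => (1 : ℝ) :=
    isBigO_dot (F.position_isBigO_one hne hreg hl) _
  have hYO : (fun q : ι × ℝ => Y q.1 q.2) =O[l ×ˢ 𝓟 (Icc (0 : ℝ) 1)] fun _ => (1 : ℝ) :=
    isBigO_dot (F.position_isBigO_one hne hreg hl) _
  have hWO : (fun q : ι × ℝ => W q.1 q.2) =O[l ×ˢ 𝓟 (Icc (0 : ℝ) 1)] fun _ => (1 : ℝ) := by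
    have h1 : (fun q : ι × ℝ => l0 q.1) =O[l ×ˢ 𝓟 (Icc (0 : ℝ) 1)] fun _ => (1 : ℝ) :=
      (hl.isBigO_one ℝ).comp_tendsto tendsto_fst
    exact (h1.neg_left.mul (F.inv_potentialC_isBigO_one hreg)).congr
      (fun q => (div_eq_mul_inv _ _).symm) fun _ => one_mul 1
  have hrinv : (fun q : ι × ℝ => ‖x q.1 q.2‖⁻¹) =O[l ×ˢ 𝓟 (Icc (0 : ℝ) 1)]
      fun _ => (1 : ℝ) := by
    refine IsBigO.of_bound δ⁻¹ ?_
    rw [eventually_prod_principal_iff]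
    filter_upwards [hreg.2] with i hi s hs
    have := hi s hs
    have hδ := hreg.1
    rw [norm_inv, norm_norm, norm_one, mul_one]
    gcongr
  -- eventual facts
  have hbpos : ∀ᶠ i in l, 0 < b i := by
    have : Tendsto b l (𝓝 rc) := by
      simpa using (hbl.trans_tendsto F.mass_tendsto_zero).add_const rc
    exact this.eventually_const_lt hrc0
  have hYpos : ∀ᶠ i in l, ∀ s ∈ Icc (0 : ℝ) 1, 0 < Y i s := by
    have : Tendsto (fun q : ι × ℝ => Y q.1 q.2) (l ×ˢ 𝓟 (Icc (0 : ℝ) 1)) (𝓝 rc) := by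
      simpa using (hη.trans_tendsto F.mass_tendsto_prod).add_const rc
    exact eventually_prod_principal_iff.1 (this.eventually_const_lt hrc0)
  have hplane : ∀ᶠ i in l, ∀ s ∈ Icc (0 : ℝ) 1, X i s ^ 2 + Y i s ^ 2 = ‖x i s‖ ^ 2
      ∧ X i s * v i s - Y i s * u i s = b i := by
    filter_upwards [F.ray, F.start, F.finish, hb, hbpos] with i hi h0 h1 hbi hbp s hs
    have hc := hi.neg_cross_eq hx h0 h1 hs
    rw [← hbi] at hc
    -- The position is orthogonal to the angular momentum bQ, and b ≠ 0.
    have hxQ : dot (x i s) (vecQ xA xB) = 0 := by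
      have h2 : dot (x i s) (-cross (x i s) (p i s)) = 0 := by
        rw [← neg_one_smul ℝ, dot_smul_right, dot_cross_left, mul_zero]
      rw [hc, dot_smul_right] at h2
      exact (mul_eq_zero.1 h2).resolve_left hbp.ne'
    refine ⟨(norm_sq_of_dot_vecQ_eq_zero hx hxQ).symm, ?_⟩
    have h3 := dot_neg_cross_vecQ hx (x i s) (p i s)
    rw [hc, dot_smul_left, dot_vecQ_self hx, mul_one] at h3
    exact h3.symm
  -- The corrected transverse component has derivative O(m³), so its increment is O(m³); evaluating
  -- the primitive at the known end points gives the formula.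
  have key := isBigO_sub_of_hasDerivWithinAt (l := l) (a := 1) zero_le_one
    (e := fun i => m i ^ 3)
    (G := fun i z => v i z - g * m i / b i * (X i z / √(X i z ^ 2 + Y i z ^ 2))
      - κ * m i ^ 2 / rc * (Real.arctan (X i z / Y i z) / rc + X i z / (X i z ^ 2 + Y i z ^ 2)))
    (G' := fun i s => W i s * (-M i s * Y i s + g * m i / b i * b i * Y i s / ‖x i s‖ ^ 3
        - κ * m i ^ 2 / rc * (-b i / (rc * ‖x i s‖ ^ 2) + u i s / ‖x i s‖ ^ 2
          - 2 * X i s * (X i s * u i s + Y i s * v i s) / ‖x i s‖ ^ 4))) ?_ ?_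
  · refine (key.comp_tendsto (tendsto_prodMk_principal (right_mem_Icc.2 zero_le_one))).congr' ?_
      EventuallyEq.rfl
    filter_upwards [F.start, F.finish] with i h0 h1
    have sA : √(rA ^ 2) = rA := by rw [hrA, Real.sqrt_sq (norm_nonneg _)]
    have sB : √(rB ^ 2) = rB := by rw [hrB, Real.sqrt_sq (norm_nonneg _)]
    have qA : tA ^ 2 + rc ^ 2 = rA ^ 2 := by rw [htA, hrc, ← norm_sq_left hx, hrA]
    have qB : tB ^ 2 + rc ^ 2 = rB ^ 2 := by rw [htB, hrc, ← norm_sq_right hx, hrB]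
    have x1 : X i 1 = tA := by simp only [hX, h1, htA]
    have x0 : X i 0 = tB := by simp only [hX, h0, htB]
    have y1 : Y i 1 = rc := by simp only [hY, h1, hrc]; exact dot_left_vecP hx
    have y0 : Y i 0 = rc := by simp only [hY, h0, hrc]; exact dot_right_vecP hx
    simp only [Function.comp_def, x1, x0, y1, y0, qA, qB, sA, sB, hv]
    ring
  · filter_upwards [F.ray, hYpos, hplane] with i hi hYp hpl s hs
    have hdX : HasDerivWithinAt (X i) (W i s * u i s) (Icc 0 1) s := by
      have := (hi.position s hs).inner ℝ (hasDerivWithinAt_const s (Icc (0 : ℝ) 1) (vecN xA xB))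
      refine this.congr_deriv ?_
      rw [inner_zero_right, zero_add]; exact dot_smul_left _ _ _
    have hdY : HasDerivWithinAt (Y i) (W i s * v i s) (Icc 0 1) s := by
      have := (hi.position s hs).inner ℝ (hasDerivWithinAt_const s (Icc (0 : ℝ) 1) (vecP xA xB))
      refine this.congr_deriv ?_
      rw [inner_zero_right, zero_add]; exact dot_smul_left _ _ _
    have hdv : HasDerivWithinAt (v i) (W i s * (-M i s * Y i s)) (Icc 0 1) s := by
      have := (hi.momentum s hs).inner ℝ (hasDerivWithinAt_const s (Icc (0 : ℝ) 1) (vecP xA xB))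
      refine this.congr_deriv ?_
      rw [inner_zero_right, zero_add]
      exact (dot_smul_left _ _ _).trans (congrArg _ (dot_smul_left _ _ _))
    exact hasDerivWithinAt_deflection hdX hdY hdv (hYp s hs) (hpl s hs).2
      (norm_pos_iff.2 (hi.ne_zero s hs)) (hpl s hs).1
  · -- the derivative is of third order
    set L := l ×ˢ 𝓟 (Icc (0 : ℝ) 1)
    have hy2 : (fun q : ι × ℝ => deriv (fun z => fC z / fA z) (m q.1 / ‖x q.1 q.2‖)
        - (2 * g + 4 * κ * (m q.1 / ‖x q.1 q.2‖))) =O[L] fun q => m q.1 ^ 2 :=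
      (F.profile.derivIndex.comp_tendsto (F.ratio_tendsto hreg)).trans
        ((ratio_isBigO hreg).pow 2)
    -- This term is the Taylor remainder of the index derivative. The terms `j1` to `j4` are the
    -- deviations of Y, b, u and v from the straight line; each is O(m) and is multiplied by κm².
    have k1 : (fun q : ι × ℝ => 1 / 2 * ‖x q.1 q.2‖⁻¹ ^ 3 * Y q.1 q.2 *
        (deriv (fun z => fC z / fA z) (m q.1 / ‖x q.1 q.2‖)
        - (2 * g + 4 * κ * (m q.1 / ‖x q.1 q.2‖))) * m q.1) =O[L] fun q => m q.1 ^ 3 := by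
      have := ((((hrinv.pow 3).const_mul_left (1 / 2)).mul hYO).mul hy2).mul hmO
      refine this.congr_right fun q => ?_
      ring
    have hr2 : (fun q : ι × ℝ => X q.1 q.2 ^ 2 + Y q.1 q.2 ^ 2) =O[L] fun _ => (1 : ℝ) := by
      simpa using (hXO.pow 2).add (hYO.pow 2)
    have j1 : (fun q : ι × ℝ => (Y q.1 q.2 - rc) * (-2 * Y q.1 q.2 / rc)) =O[L]
        fun q => m q.1 * 1 := hη.mul (by
          simpa [div_eq_inv_mul, mul_assoc] using hYO.const_mul_left (rc⁻¹ * -2))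
    have j2 : (fun q : ι × ℝ => (b q.1 - rc) * (-(rc ^ 2)⁻¹ * (X q.1 q.2 ^ 2 + Y q.1 q.2 ^ 2)))
        =O[L] fun q => m q.1 * 1 := hbO.mul (hr2.const_mul_left _)
    have j3 : (fun q : ι × ℝ => (u q.1 q.2 + 1) * (rc⁻¹ * (Y q.1 q.2 ^ 2 - X q.1 q.2 ^ 2)))
        =O[L] fun q => m q.1 * 1 := by
      have : (fun q : ι × ℝ => Y q.1 q.2 ^ 2 - X q.1 q.2 ^ 2) =O[L] fun _ => (1 : ℝ) := by
        simpa using (hYO.pow 2).sub (hXO.pow 2)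
      exact hα.mul (this.const_mul_left _)
    have j4 : (fun q : ι × ℝ => v q.1 q.2 * (-2 * rc⁻¹ * (X q.1 q.2 * Y q.1 q.2)))
        =O[L] fun q => m q.1 * 1 := by
      have : (fun q : ι × ℝ => X q.1 q.2 * Y q.1 q.2) =O[L] fun _ => (1 : ℝ) := by
        simpa using hXO.mul hYO
      exact hvO.mul (this.const_mul_left _)
    have k2 := ((hrinv.pow 4).mul (((j1.add j2).add j3).add j4)).const_mul_left (κ)
    have k3 := k2.mul ((isBigO_refl (fun q : ι × ℝ => m q.1 ^ 2) L))
    have k4 := k1.add (k3.congr_right (g₂ := fun q => m q.1 ^ 3) fun q => by ring)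
    have k5 := (hWO.neg_left.mul k4)
    simp only [one_mul] at k5
    refine k5.congr' ?_ EventuallyEq.rfl
    rw [EventuallyEq, eventually_prod_principal_iff]
    filter_upwards [F.ray, hbpos, hplane] with i hi hbp hpl s hs
    have hr : ‖x i s‖ ≠ 0 := norm_ne_zero_iff.2 (hi.ne_zero s hs)
    have hb1 := hbp.ne'
    have hr1 := hrc0.ne'
    have hsq := (hpl s hs).1
    simp only [hM]
    generalize deriv (fun z => fC z / fA z) (m i / ‖x i s‖) = D
    generalize ‖x i s‖ = r at *
    generalize X i s = X' at *
    generalize Y i s = Y' at *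
    generalize u i s = u' at *
    generalize v i s = v' at *
    generalize W i s = W' at *
    -- Once everything is over r⁴ with r² = X² + Y², the bracket differs from −2Y r_c/r⁴·(b, u, v, Y
    -- at zeroth order) only by multiples of Y − r_c, b − r_c, u + 1 and v.
    have e : (-b i / (rc * r ^ 2) + u' / r ^ 2 - 2 * X' * (X' * u' + Y' * v') / r ^ 4)
        = (-b i * r ^ 2 / rc + u' * r ^ 2 - 2 * X' * (X' * u' + Y' * v')) / r ^ 4 := by
      field_simp
    rw [e, ← hsq]
    field_simp
    ring

end RayFamily

end Family

/-! ### Trigonometry of the end points -/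

/-- Planar positions `(tA, rc)`, `(tB, rc)` of the end points, at distances `rA`, `rB` from the
centre. -/
structure EndpointData (tA tB rA rB rc : ℝ) : Prop where
  rc_pos : 0 < rc
  rA_pos : 0 < rA
  rB_pos : 0 < rB
  lt : tA < tB
  sqA : rA ^ 2 = tA ^ 2 + rc ^ 2
  sqB : rB ^ 2 = tB ^ 2 + rc ^ 2

/-- Taking a = r + t, so that c²/a = r − t, removes the square root: identities between end-point
quantities become identities of rational functions. -/
lemma exists_rational_param {t r c : ℝ} (hc : 0 < c) (hr : 0 < r) (h : r ^ 2 = t ^ 2 + c ^ 2) :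
    ∃ a : ℝ, 0 < a ∧ t = (a - c ^ 2 / a) / 2 ∧ r = (a + c ^ 2 / a) / 2 := by
  have ha : 0 < r + t := by
    have : |t| < r := abs_lt_of_sq_lt_sq (by nlinarith) hr.le
    linarith [neg_abs_le t]
  have e : c ^ 2 / (r + t) = r - t := by rw [div_eq_iff ha.ne']; linarith
  refine ⟨r + t, ha, ?_, ?_⟩ <;> rw [e] <;> ring

namespace EndpointData

variable {tA tB rA rB rc : ℝ}

/-- This quantity is r_A r_B (1 + n_A·n_B), the denominator H of the final formulas; in rational
parameters it is a square over a positive number. -/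
lemma denom_pos (h : EndpointData tA tB rA rB rc) : 0 < rA * rB + tA * tB + rc ^ 2 := by
  obtain ⟨a, ha, e1, e2⟩ := exists_rational_param h.rc_pos h.rA_pos h.sqA
  obtain ⟨b, hb, e3, e4⟩ := exists_rational_param h.rc_pos h.rB_pos h.sqB
  have hc := h.rc_pos
  have : rA * rB + tA * tB + rc ^ 2 = (a * b + rc ^ 2) ^ 2 / (2 * a * b) := by
    rw [e1, e2, e3, e4]; field_simp; ring
  rw [this]; positivity

/-- Divided by (r_A r_B)² this is (1 + cos φ)² + sin² φ = 2(1 + cos φ), with φ the angle at the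
centre. -/
lemma half_angle (h : EndpointData tA tB rA rB rc) :
    (rA * rB + tA * tB + rc ^ 2) ^ 2 + rc ^ 2 * (tB - tA) ^ 2
      = 2 * rA * rB * (rA * rB + tA * tB + rc ^ 2) := by
  linear_combination (rB ^ 2 - rc ^ 2 - tB ^ 2 + tB ^ 2 + rc ^ 2) * (-h.sqA)
    - (rc ^ 2 + tA ^ 2) * h.sqB

/-- Together with `slope_right` this evaluates the first-order coefficients of v at the two ends,
after elimination of b and of the N-components; the factor t_B − t_A is the determinant of the
linear system. -/
lemma slope_left (h : EndpointData tA tB rA rB rc) :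
    tB * (tA / rA - tB / rB) / rc + rc * (1 / rA - 1 / rB)
      = (tB - tA) * -(rc * (tB - tA) / (rA * (rA * rB + tA * tB + rc ^ 2))) := by
  have hd := h.denom_pos
  obtain ⟨a, ha, e1, e2⟩ := exists_rational_param h.rc_pos h.rA_pos h.sqA
  obtain ⟨b, hb, e3, e4⟩ := exists_rational_param h.rc_pos h.rB_pos h.sqB
  have hc := h.rc_pos
  have e5 : rA * rB + tA * tB + rc ^ 2 = (a * b + rc ^ 2) ^ 2 / (2 * a * b) := by
    rw [e1, e2, e3, e4]; field_simp; ring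
  rw [e5, e1, e2, e3, e4]; field_simp; ring

lemma slope_right (h : EndpointData tA tB rA rB rc) :
    tA * (tA / rA - tB / rB) / rc + rc * (1 / rA - 1 / rB)
      = (tB - tA) * (rc * (tB - tA) / (rB * (rA * rB + tA * tB + rc ^ 2))) := by
  have hd := h.denom_pos
  obtain ⟨a, ha, e1, e2⟩ := exists_rational_param h.rc_pos h.rA_pos h.sqA
  obtain ⟨b, hb, e3, e4⟩ := exists_rational_param h.rc_pos h.rB_pos h.sqB
  have hc := h.rc_pos
  have e5 : rA * rB + tA * tB + rc ^ 2 = (a * b + rc ^ 2) ^ 2 / (2 * a * b) := by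
    rw [e1, e2, e3, e4]; field_simp; ring
  rw [e5, e1, e2, e3, e4]; field_simp; ring

lemma impact_first (h : EndpointData tA tB rA rB rc) :
    tA * -(rc * (tB - tA) / (rA * (rA * rB + tA * tB + rc ^ 2))) + rc / rA
      = rc * (rA + rB) / (rA * rB + tA * tB + rc ^ 2) := by
  have hd := h.denom_pos.ne'
  have hA := h.rA_pos.ne'
  field_simp
  linear_combination (-rc) * h.sqA

lemma impact_second (h : EndpointData tA tB rA rB rc) :
    tA * (tB - tA) * rc ^ 2 * (rA + rB) - rc ^ 2 * rB * (rA * rB + tA * tB + rc ^ 2)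
      = -(rA * (rA * rB + tA * tB + rc ^ 2) * (rA * rB - tA * tB)) := by
  obtain ⟨a, ha, e1, e2⟩ := exists_rational_param h.rc_pos h.rA_pos h.sqA
  obtain ⟨b, hb, e3, e4⟩ := exists_rational_param h.rc_pos h.rB_pos h.sqB
  have hc := h.rc_pos
  rw [e1, e2, e3, e4]; field_simp; ring

/-- The angle at the centre. -/
lemma arctan_sub_arctan (h : EndpointData tA tB rA rB rc) :
    Real.arctan (tB / rc) - Real.arctan (tA / rc)
      = Real.arccos ((tA * tB + rc ^ 2) / (rA * rB)) := by
  have hc := h.rc_pos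
  have hA := h.rA_pos
  have hB := h.rB_pos
  have hlt : Real.arctan (tA / rc) < Real.arctan (tB / rc) :=
    Real.arctan_strictMono (div_lt_div_of_pos_right h.lt hc)
  have hsq : ∀ {t r : ℝ}, 0 < r → r ^ 2 = t ^ 2 + rc ^ 2 → √(1 + (t / rc) ^ 2) = r / rc := by
    intro t r hr e
    rw [show 1 + (t / rc) ^ 2 = (r / rc) ^ 2 by field_simp; rw [e]; ring,
      Real.sqrt_sq (by positivity)]
  have hcos : Real.cos (Real.arctan (tB / rc) - Real.arctan (tA / rc))
      = (tA * tB + rc ^ 2) / (rA * rB) := by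
    rw [Real.cos_sub, Real.cos_arctan, Real.cos_arctan, Real.sin_arctan, Real.sin_arctan,
      hsq hA h.sqA, hsq hB h.sqB]
    field_simp
    ring
  -- The difference of two arctangents, taken in increasing order, lies in [0, π], where
  -- `Real.arccos` inverts the cosine.
  rw [← hcos, Real.arccos_cos]
  · linarith
  · linarith [Real.arctan_lt_pi_div_two (tB / rc), Real.neg_pi_div_two_lt_arctan (tA / rc)]

end EndpointData

/-! ### Elimination to second order -/

section Scalar

variable {ι : Type*} {l : Filter ι} {m b : ι → ℝ} {g κ rc r b₁ v₁ : ℝ} {u v : ι → ℝ}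

/-- Since v² and (u + 1)² are already O(m²), the energy identity fixes u to first order without v.
-/
lemma energy_first_order (hm : Tendsto m l (𝓝 0)) (hu : (fun i => u i + 1) =O[l] m)
    (hv : v =O[l] m)
    (hE : (fun i => u i ^ 2 + v i ^ 2 - (1 + 2 * g * (m i / r) + 2 * κ * (m i / r) ^ 2)) =O[l]
      fun i => m i ^ 3) :
    (fun i => u i + 1 + g * m i / r) =O[l] fun i => m i ^ 2 := by
  have h32 : (fun i => m i ^ 3) =O[l] fun i => m i ^ 2 := by
    have := (isBigO_refl (fun i => m i ^ 2) l).mul (hm.isBigO_one ℝ)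
    exact this.congr (fun i => by ring) fun i => by ring
  have hmm := (isBigO_refl (fun i => m i ^ 2) l).const_mul_left (2 * κ / r ^ 2)
  have := ((((hu.pow 2).add (hv.pow 2)).sub hmm).sub (hE.trans h32)).const_mul_left (1 / 2)
  refine this.congr_left fun i => ?_
  ring

lemma isBigO_sq_sub_sq {f h : ι → ℝ} (hf : f =O[l] m) (hh : h =O[l] m)
    (hd : (fun i => f i - h i) =O[l] fun i => m i ^ 2) :
    (fun i => f i ^ 2 - h i ^ 2) =O[l] fun i => m i ^ 3 :=
  (hd.mul (hf.add hh)).congr (fun i => by ring) fun i => by ring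

/-- Squares of O(m) quantities known up to O(m²) are known up to O(m³), so the first-order part of v
fixes u to second order. This is what lets the elimination proceed order by order. -/
lemma energy_second_order (hm : Tendsto m l (𝓝 0)) (hu : (fun i => u i + 1) =O[l] m)
    (hv : v =O[l] m) (hv₁ : (fun i => v i - m i * v₁) =O[l] fun i => m i ^ 2)
    (hE : (fun i => u i ^ 2 + v i ^ 2 - (1 + 2 * g * (m i / r) + 2 * κ * (m i / r) ^ 2)) =O[l]
      fun i => m i ^ 3) :
    (fun i => u i + 1 + g * m i / r - m i ^ 2 * (1 / 2 * (g ^ 2 / r ^ 2 + v₁ ^ 2) - κ / r ^ 2))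
      =O[l] fun i => m i ^ 3 := by
  have h1 := energy_first_order hm hu hv hE
  have h2 : (fun i => (u i + 1) ^ 2 - (-(g / r) * m i) ^ 2) =O[l] fun i => m i ^ 3 :=
    isBigO_sq_sub_sq hu ((isBigO_refl m l).const_mul_left _)
      (h1.congr_left fun i => by ring)
  have h3 : (fun i => v i ^ 2 - (v₁ * m i) ^ 2) =O[l] fun i => m i ^ 3 :=
    isBigO_sq_sub_sq hv ((isBigO_refl m l).const_mul_left _)
      (hv₁.congr_left fun i => by ring)
  refine (((h2.add h3).sub hE).const_mul_left (1 / 2)).congr_left fun i => ?_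
  ring

lemma inv_impact_first_order (hm : Tendsto m l (𝓝 0)) (hrc : 0 < rc)
    (hb : (fun i => b i - rc) =O[l] m) :
    (fun i => m i / b i - m i / rc) =O[l] fun i => m i ^ 2 := by
  have hbl : Tendsto b l (𝓝 rc) := by simpa using (hb.trans_tendsto hm).add_const rc
  have hinv : (fun i => (b i)⁻¹) =O[l] fun _ => (1 : ℝ) := (hbl.inv₀ hrc.ne').isBigO_one ℝ
  have := (((isBigO_refl m l).mul hb).mul hinv).const_mul_left (-rc⁻¹)
  refine this.congr' ?_ (Eventually.of_forall fun i => by ring)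
  filter_upwards [hbl.eventually_ne hrc.ne'] with i hi
  field_simp
  ring

lemma inv_impact_second_order (hm : Tendsto m l (𝓝 0)) (hrc : 0 < rc)
    (hb : (fun i => b i - rc) =O[l] m)
    (hb₁ : (fun i => b i - rc - m i * b₁) =O[l] fun i => m i ^ 2) :
    (fun i => m i / b i - (m i / rc - m i ^ 2 * b₁ / rc ^ 2)) =O[l] fun i => m i ^ 3 := by
  have hbl : Tendsto b l (𝓝 rc) := by simpa using (hb.trans_tendsto hm).add_const rc
  have h1 := (isBigO_refl m l).mul (hb₁.const_mul_left (-rc⁻¹))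
  have h2 := ((isBigO_refl m l).mul (inv_impact_first_order hm hrc hb)).const_mul_left (-b₁ / rc)
  have hinv : (fun i => (b i)⁻¹) =O[l] fun _ => (1 : ℝ) := (hbl.inv₀ hrc.ne').isBigO_one ℝ
  refine ((h1.mul hinv).add (h2.congr_right (g₂ := fun i => m i * m i ^ 2 * 1)
    fun i => by ring)).congr' ?_ (Eventually.of_forall fun i => by ring)
  filter_upwards [hbl.eventually_ne hrc.ne'] with i hi
  field_simp
  ring

end Scalar

namespace EndpointData

variable {tA tB rA rB rc : ℝ}

/-- The coefficients of (1+γ)² in the second-order slopes; the κ parts, which carry the angle Φ, are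
in `slope_angle_left` and `slope_angle_right`. -/
lemma slope_second_left (h : EndpointData tA tB rA rB rc) {H : ℝ}
    (hH : H = rA * rB + tA * tB + rc ^ 2) :
    -(tB * (rc * (rA + rB) / H) / rc ^ 2 * (tA / rA - tB / rB))
        - rc * (rB / (rA * H) - rA / (rB * H))
      = (tB - tA) * (rc / rA * (rc * (tB - tA) / H) * (rc * (rA + rB) / H) / rc ^ 2) := by
  obtain ⟨a, ha, e1, e2⟩ := exists_rational_param h.rc_pos h.rA_pos h.sqA
  obtain ⟨b, hb, e3, e4⟩ := exists_rational_param h.rc_pos h.rB_pos h.sqB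
  have hc := h.rc_pos
  have e5 : H = (a * b + rc ^ 2) ^ 2 / (2 * a * b) := by
    rw [hH, e1, e2, e3, e4]; field_simp; ring
  rw [e5, e1, e2, e3, e4]; field_simp; ring

lemma slope_second_right (h : EndpointData tA tB rA rB rc) {H : ℝ}
    (hH : H = rA * rB + tA * tB + rc ^ 2) :
    -(tA * (rc * (rA + rB) / H) / rc ^ 2 * (tA / rA - tB / rB))
        - rc * (rB / (rA * H) - rA / (rB * H))
      = (tB - tA) * -(rc / rB * (rc * (tB - tA) / H) * (rc * (rA + rB) / H) / rc ^ 2) := by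
  obtain ⟨a, ha, e1, e2⟩ := exists_rational_param h.rc_pos h.rA_pos h.sqA
  obtain ⟨b, hb, e3, e4⟩ := exists_rational_param h.rc_pos h.rB_pos h.sqB
  have hc := h.rc_pos
  have e5 : H = (a * b + rc ^ 2) ^ 2 / (2 * a * b) := by
    rw [hH, e1, e2, e3, e4]; field_simp; ring
  rw [e5, e1, e2, e3, e4]; field_simp; ring

lemma slope_angle_left (h : EndpointData tA tB rA rB rc) (Φ : ℝ) :
    tB / rc * (-Φ / rc + (tA / rA ^ 2 - tB / rB ^ 2)) + rc * (1 / rA ^ 2 - 1 / rB ^ 2)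
      = (tB - tA) * -(rc / rA * (Φ * (rA * rB / (rc * (tB - tA))) * (tB / rB) - tA / rA)
        / rc ^ 2) := by
  have hc := h.rc_pos.ne'
  have hA := h.rA_pos.ne'
  have hB := h.rB_pos.ne'
  have hR : tB - tA ≠ 0 := (sub_pos.2 h.lt).ne'
  have e : (tB - tA) * -(rc / rA * (Φ * (rA * rB / (rc * (tB - tA))) * (tB / rB) - tA / rA)
        / rc ^ 2) = -(Φ * tB / rc ^ 2) + (tB - tA) * tA / (rc * rA ^ 2) := by
    field_simp; ring
  rw [e, h.sqA, h.sqB]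
  have h1 : tA ^ 2 + rc ^ 2 ≠ 0 := by positivity
  have h2 : tB ^ 2 + rc ^ 2 ≠ 0 := by positivity
  field_simp
  ring

lemma slope_angle_right (h : EndpointData tA tB rA rB rc) (Φ : ℝ) :
    tA / rc * (-Φ / rc + (tA / rA ^ 2 - tB / rB ^ 2)) + rc * (1 / rA ^ 2 - 1 / rB ^ 2)
      = (tB - tA) * -(rc / rB * (Φ * (rA * rB / (rc * (tB - tA))) * (tA / rA) - tB / rB)
        / rc ^ 2) := by
  have hc := h.rc_pos.ne'
  have hA := h.rA_pos.ne'
  have hB := h.rB_pos.ne'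
  have hR : tB - tA ≠ 0 := (sub_pos.2 h.lt).ne'
  have e : (tB - tA) * -(rc / rB * (Φ * (rA * rB / (rc * (tB - tA))) * (tA / rA) - tB / rB)
        / rc ^ 2) = -(Φ * tA / rc ^ 2) + (tB - tA) * tB / (rc * rB ^ 2) := by
    field_simp; ring
  rw [e, h.sqA, h.sqB]
  have h1 : tA ^ 2 + rc ^ 2 ≠ 0 := by positivity
  have h2 : tB ^ 2 + rc ^ 2 ≠ 0 := by positivity
  field_simp
  ring

end EndpointData

section Scalar

variable {ι : Type*} {l : Filter ι} {m b uA vA uB vB : ι → ℝ} {g κ tA tB rA rB rc Φ H : ℝ}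

/-- Solution of the boundary value problem to second order. -/
lemma second_order_expansions (E : EndpointData tA tB rA rB rc)
    (hH : H = rA * rB + tA * tB + rc ^ 2)
    (hm : Tendsto m l (𝓝 0)) (hb : (fun i => b i - rc) =O[l] m)
    (huA : (fun i => uA i + 1) =O[l] m) (huB : (fun i => uB i + 1) =O[l] m)
    (hvA : vA =O[l] m) (hvB : vB =O[l] m)
    (hEA : (fun i => uA i ^ 2 + vA i ^ 2 - (1 + 2 * g * (m i / rA) + 2 * κ * (m i / rA) ^ 2))
      =O[l] fun i => m i ^ 3)
    (hEB : (fun i => uB i ^ 2 + vB i ^ 2 - (1 + 2 * g * (m i / rB) + 2 * κ * (m i / rB) ^ 2))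
      =O[l] fun i => m i ^ 3)
    (hbA : ∀ᶠ i in l, b i = tA * vA i - rc * uA i) (hbB : ∀ᶠ i in l, b i = tB * vB i - rc * uB i)
    (hD : (fun i => vA i - vB i - (g * m i / b i * (tA / rA - tB / rB) + κ * m i ^ 2 / rc *
      (-Φ / rc + (tA / rA ^ 2 - tB / rB ^ 2)))) =O[l] fun i => m i ^ 3) :
    (fun i => b i - (rc + m i * (g * (rc * (rA + rB) / H)) + m i ^ 2 * (1 / rc *
        (κ * (1 - Φ * (rA * rB / (rc * (tB - tA))) * (tA / rA * (tB / rB)))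
          - g ^ 2 * ((1 - tA / rA * (tB / rB)) * (rA * rB / H)))))) =O[l] (fun i => m i ^ 3) ∧
    (fun i => uA i + 1 + rc / rA * (g * (m i / b i) + (m i / b i) ^ 2 *
        (κ * (rc / rA) + g ^ 2 * (rc * rA / H)))) =O[l] (fun i => m i ^ 3) ∧
    (fun i => vA i + rc / rA * (g * (rc * (tB - tA) / H) * (m i / b i) + κ * (m i / b i) ^ 2 *
        (Φ * (rA * rB / (rc * (tB - tA))) * (tB / rB) - tA / rA))) =O[l] (fun i => m i ^ 3) ∧
    (fun i => uB i + 1 + rc / rB * (g * (m i / b i) + (m i / b i) ^ 2 *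
        (κ * (rc / rB) + g ^ 2 * (rc * rB / H)))) =O[l] (fun i => m i ^ 3) ∧
    (fun i => vB i - rc / rB * (g * (rc * (tB - tA) / H) * (m i / b i) - κ * (m i / b i) ^ 2 *
        (Φ * (rA * rB / (rc * (tB - tA))) * (tA / rA) - tB / rB))) =O[l] fun i => m i ^ 3 := by
  have hc := E.rc_pos.ne'
  have hA := E.rA_pos.ne'
  have hB := E.rB_pos.ne'
  have hR : tB - tA ≠ 0 := (sub_pos.2 E.lt).ne'
  have hH0 : H ≠ 0 := hH ▸ E.denom_pos.ne'
  have h32 : (fun i => m i ^ 3) =O[l] fun i => m i ^ 2 := by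
    have := (isBigO_refl (fun i => m i ^ 2) l).mul (hm.isBigO_one ℝ)
    exact this.congr (fun i => by ring) fun i => by ring
  -- first order
  have inv1 := inv_impact_first_order hm E.rc_pos hb
  have eA1 := energy_first_order hm huA hvA hEA
  have eB1 := energy_first_order hm huB hvB hEB
  have D1 : (fun i => vA i - vB i - g * (m i / rc) * (tA / rA - tB / rB)) =O[l]
      fun i => m i ^ 2 := by
    have h1 := inv1.const_mul_left (g * (tA / rA - tB / rB))
    have h2 := (isBigO_refl (fun i => m i ^ 2) l).const_mul_left
      (κ / rc * (-Φ / rc + (tA / rA ^ 2 - tB / rB ^ 2)))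
    refine (((hD.trans h32).add h1).add h2).congr_left fun i => ?_
    ring
  -- Equating the two expressions for b and inserting the change of v gives (t_B − t_A) v_A = t_B
  -- (v_A − v_B) − r_c (u_A − u_B). The same relation is reused at second order, and with t_A in
  -- place of t_B it gives v_B.
  have vA1 : (fun i => vA i - m i * -(g * (rc * (tB - tA) / (rA * H)))) =O[l]
      fun i => m i ^ 2 := by
    have := ((D1.const_mul_left tB).sub ((eA1.sub eB1).const_mul_left rc)).const_mul_left
      (tB - tA)⁻¹
    refine this.congr' ?_ EventuallyEq.rfl
    filter_upwards [hbA, hbB] with i h1 h2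
    have h3 := E.slope_left
    rw [← hH] at h3
    rw [inv_mul_eq_iff_eq_mul₀ hR]
    linear_combination h2 - h1 - g * m i * h3
  have vB1 : (fun i => vB i - m i * (g * (rc * (tB - tA) / (rB * H)))) =O[l]
      fun i => m i ^ 2 := by
    have := ((D1.const_mul_left tA).sub ((eA1.sub eB1).const_mul_left rc)).const_mul_left
      (tB - tA)⁻¹
    refine this.congr' ?_ EventuallyEq.rfl
    filter_upwards [hbA, hbB] with i h1 h2
    have h3 := E.slope_right
    rw [← hH] at h3
    rw [inv_mul_eq_iff_eq_mul₀ hR]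
    linear_combination h2 - h1 - g * m i * h3
  have b1 : (fun i => b i - rc - m i * (g * (rc * (rA + rB) / H))) =O[l] fun i => m i ^ 2 := by
    refine ((vA1.const_mul_left tA).sub (eA1.const_mul_left rc)).congr' ?_ EventuallyEq.rfl
    filter_upwards [hbA] with i h1
    have h3 := E.impact_first
    rw [← hH] at h3
    linear_combination -h1 - g * m i * h3
  -- second order
  have inv2 := inv_impact_second_order hm E.rc_pos hb b1
  have invsq : (fun i => (m i / b i) ^ 2 - m i ^ 2 / rc ^ 2) =O[l] fun i => m i ^ 3 := by
    have hmrc : (fun i => m i / rc) =O[l] m :=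
      ((isBigO_refl m l).const_mul_left rc⁻¹).congr_left fun i => by ring
    have hmb : (fun i => m i / b i) =O[l] m := by
      have hmm : (fun i => m i ^ 2) =O[l] m := by
        have := (isBigO_refl m l).mul (hm.isBigO_one ℝ)
        exact this.congr (fun i => by ring) fun i => by ring
      exact ((inv1.trans hmm).add hmrc).congr_left fun i => by ring
    exact (isBigO_sq_sub_sq hmb hmrc inv1).congr_left fun i => by ring
  have hhalf := E.half_angle
  rw [← hH] at hhalf
  -- By the half-angle identity the squared first-order slope combines with 1/r_A² into a single
  -- fraction over H.
  have cA : 1 / 2 * (g ^ 2 / rA ^ 2 + (-(g * (rc * (tB - tA) / (rA * H)))) ^ 2) - κ / rA ^ 2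
      = g ^ 2 * (rB / (rA * H)) - κ / rA ^ 2 := by
    field_simp
    linear_combination g ^ 2 * hhalf
  have cB : 1 / 2 * (g ^ 2 / rB ^ 2 + (g * (rc * (tB - tA) / (rB * H))) ^ 2) - κ / rB ^ 2
      = g ^ 2 * (rA / (rB * H)) - κ / rB ^ 2 := by
    field_simp
    linear_combination g ^ 2 * hhalf
  have eA2 := energy_second_order hm huA hvA vA1 hEA
  have eB2 := energy_second_order hm huB hvB vB1 hEB
  rw [cA] at eA2
  rw [cB] at eB2
  have D2 : (fun i => vA i - vB i - (g * (m i / rc - m i ^ 2 * (g * (rc * (rA + rB) / H)) / rc ^ 2)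
      * (tA / rA - tB / rB) + κ * m i ^ 2 / rc * (-Φ / rc + (tA / rA ^ 2 - tB / rB ^ 2)))) =O[l]
      fun i => m i ^ 3 := by
    refine (hD.add (inv2.const_mul_left (g * (tA / rA - tB / rB)))).congr_left fun i => ?_
    ring
  have vA2 : (fun i => vA i - (m i * -(g * (rc * (tB - tA) / (rA * H))) + m i ^ 2 *
      (-(rc / rA * (κ * (Φ * (rA * rB / (rc * (tB - tA))) * (tB / rB) - tA / rA)
        - g ^ 2 * (rc * (tB - tA) / H) * (rc * (rA + rB) / H)) / rc ^ 2)))) =O[l]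
      fun i => m i ^ 3 := by
    have := ((D2.const_mul_left tB).sub ((eA2.sub eB2).const_mul_left rc)).const_mul_left
      (tB - tA)⁻¹
    refine this.congr' ?_ EventuallyEq.rfl
    filter_upwards [hbA, hbB] with i h1 h2
    have h3 := E.slope_left
    rw [← hH] at h3
    rw [inv_mul_eq_iff_eq_mul₀ hR]
    linear_combination h2 - h1 - g * m i * h3 - g ^ 2 * m i ^ 2 * E.slope_second_left hH
      - κ * m i ^ 2 * E.slope_angle_left Φ
  have vB2 : (fun i => vB i - (m i * (g * (rc * (tB - tA) / (rB * H))) + m i ^ 2 *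
      (-(rc / rB * (κ * (Φ * (rA * rB / (rc * (tB - tA))) * (tA / rA) - tB / rB)
        + g ^ 2 * (rc * (tB - tA) / H) * (rc * (rA + rB) / H)) / rc ^ 2)))) =O[l]
      fun i => m i ^ 3 := by
    have := ((D2.const_mul_left tA).sub ((eA2.sub eB2).const_mul_left rc)).const_mul_left
      (tB - tA)⁻¹
    refine this.congr' ?_ EventuallyEq.rfl
    filter_upwards [hbA, hbB] with i h1 h2
    have h3 := E.slope_right
    rw [← hH] at h3
    rw [inv_mul_eq_iff_eq_mul₀ hR]
    linear_combination h2 - h1 - g * m i * h3 - g ^ 2 * m i ^ 2 * E.slope_second_right hH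
      - κ * m i ^ 2 * E.slope_angle_right Φ
  refine ⟨?_, ?_, ?_, ?_, ?_⟩
  · refine ((vA2.const_mul_left tA).sub (eA2.const_mul_left rc)).congr' ?_ EventuallyEq.rfl
    filter_upwards [hbA] with i h1
    have h3 := E.impact_first
    rw [← hH] at h3
    have h4 : tA * (rc / rA * (rc * (tB - tA) / H) * (rc * (rA + rB) / H) / rc ^ 2)
        - rc * (rB / (rA * H)) = -(1 / rc * ((1 - tA / rA * (tB / rB)) * (rA * rB / H))) := by
      have h5 := E.impact_second
      rw [← hH] at h5
      field_simp
      linear_combination h5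
    have h6 : tA * (-(rc / rA * (Φ * (rA * rB / (rc * (tB - tA))) * (tB / rB) - tA / rA)
        / rc ^ 2)) + rc / rA ^ 2
        = 1 / rc * (1 - Φ * (rA * rB / (rc * (tB - tA))) * (tA / rA * (tB / rB))) := by
      have h7 : (tA ^ 2 + rc ^ 2) / rA ^ 2 = 1 := by rw [← E.sqA, div_self (pow_ne_zero 2 hA)]
      rw [show 1 / rc * (1 - Φ * (rA * rB / (rc * (tB - tA))) * (tA / rA * (tB / rB)))
        = (tA ^ 2 + rc ^ 2) / rA ^ 2 / rc
          - Φ * (rA * rB / (rc * (tB - tA))) * (tA / rA * (tB / rB)) / rc by rw [h7]; ring]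
      field_simp
      ring
    linear_combination -h1 - g * m i * h3 - g ^ 2 * m i ^ 2 * h4 - κ * m i ^ 2 * h6
  -- The solution found is a polynomial in m; here it is rewritten in m/b. Re-expanding the
  -- first-order term contributes at second order, which changes the (1+γ)² coefficient; along P
  -- that coefficient cancels.
  · have h1 := (inv2.const_mul_left (rc / rA * g)).add
      (invsq.const_mul_left (rc / rA * (κ * (rc / rA) + g ^ 2 * (rc * rA / H))))
    refine (eA2.add h1).congr_left fun i => ?_
    generalize m i / b i = z
    field_simp
    ring
  · have h1 := (inv2.const_mul_left (rc / rA * (g * (rc * (tB - tA) / H)))).add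
      (invsq.const_mul_left (rc / rA * (κ *
        (Φ * (rA * rB / (rc * (tB - tA))) * (tB / rB) - tA / rA))))
    refine (vA2.add h1).congr_left fun i => ?_
    generalize m i / b i = z
    field_simp
    ring
  · have h1 := (inv2.const_mul_left (rc / rB * g)).add
      (invsq.const_mul_left (rc / rB * (κ * (rc / rB) + g ^ 2 * (rc * rB / H))))
    refine (eB2.add h1).congr_left fun i => ?_
    generalize m i / b i = z
    field_simp
    ring
  · have h1 := (inv2.const_mul_left (rc / rB * (g * (rc * (tB - tA) / H)))).sub
      (invsq.const_mul_left (rc / rB * (κ *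
        (Φ * (rA * rB / (rc * (tB - tA))) * (tA / rA) - tB / rB))))
    refine (vB2.sub h1).congr_left fun i => ?_
    generalize m i / b i = z
    field_simp
    ring

end Scalar

/-! ### Expansions for a family of rays -/

lemma endpointData {xA xB : Triple} (hx : cross xA xB ≠ 0) :
    EndpointData (dot xA (vecN xA xB)) (dot xB (vecN xA xB)) ‖xA‖ ‖xB‖
      (closestApproach xA xB) where
  rc_pos := closestApproach_pos hx
  rA_pos := norm_pos_iff.2 (left_ne_zero_of_cross hx)
  rB_pos := norm_pos_iff.2 (right_ne_zero_of_cross hx)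
  lt := by
    have := dot_right_vecN_sub hx
    linarith [norm_pos_iff.2 (sub_ne_zero_of_cross hx)]
  sqA := norm_sq_left hx
  sqB := norm_sq_right hx

section Family

variable {ι : Type*} {l : Filter ι} {ρ g κ β γ ε : ℝ} {fA fC : ℝ → ℝ} {m b : ι → ℝ}
  {t : ι → ℝ → ℝ} {x p : ι → ℝ → Triple} {l0 : ι → ℝ} {xA xB : Triple} {δ : ℝ}

namespace RayFamily

/-- At an end point r is exactly known, so the index expansion applies with no error from the
trajectory. -/
lemma energy_isBigO (F : RayFamily l ρ g κ fA fC m t x p l0 xA xB) {s r : ℝ}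
    (hs : s ∈ Icc (0 : ℝ) 1) (hr : ∀ᶠ i in l, ‖x i s‖ = r) :
    (fun i => ‖p i s‖ ^ 2 - (1 + 2 * g * (m i / r) + 2 * κ * (m i / r) ^ 2)) =O[l]
      fun i => m i ^ 3 := by
  have hy : Tendsto (fun i => m i / r) l (𝓝 0) := by
    simpa using F.mass_tendsto_zero.div_const r
  have hmr : (fun i => m i / r) =O[l] m :=
    ((isBigO_refl m l).const_mul_left r⁻¹).congr_left fun i => by ring
  refine ((F.profile.index.comp_tendsto hy).trans (hmr.pow 3)).congr' ?_ EventuallyEq.rfl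
  filter_upwards [F.ray, hr] with i hi hri
  simp only [Function.comp_def]
  rw [hi.energy s hs, hri]

/-- The second-order expansions of the impact parameter and of the direction triples. -/
theorem expansions (F : RayFamily l ρ (1 + γ) (kappa β γ ε) fA fC m t x p l0 xA xB)
    (hx : cross xA xB ≠ 0) (hreg : StaysAway l x 1 δ) (hl : Tendsto l0 l (𝓝 (-‖xB - xA‖)))
    (hb : ∀ i, b i = dot (-cross (x i 1) (p i 1)) (vecQ xA xB)) :
    (∀ᶠ i in l, closestApproach xA xB / 2 < b i ∧ b i < 2 * closestApproach xA xB) ∧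
    (∀ᶠ i in l, ∀ s ∈ Icc (0 : ℝ) 1, -cross (x i s) (p i s) = b i • vecQ xA xB) ∧
    (fun i => b i - impactExpansion β γ ε xA xB (m i)) =O[l] (fun i => m i ^ 3) ∧
    (fun i => p i 1 - emissionExpansion β γ ε xA xB (m i) (b i)) =O[l] (fun i => m i ^ 3) ∧
    (fun i => p i 0 - receptionExpansion β γ ε xA xB (m i) (b i)) =O[l] fun i => m i ^ 3 := by
  have h00 : (0 : ℝ) ∈ Icc (0 : ℝ) 1 := left_mem_Icc.2 zero_le_one
  have h11 : (1 : ℝ) ∈ Icc (0 : ℝ) 1 := right_mem_Icc.2 zero_le_one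
  have hE := endpointData hx
  have hbB : ∀ᶠ i in l, b i = dot (-cross xB (p i 0)) (vecQ xA xB) := by
    filter_upwards [F.ray, F.start] with i hi h0
    rw [hb i, hi.cross_eq h11, h0]
  have hL : ∀ᶠ i in l, ∀ s ∈ Icc (0 : ℝ) 1, -cross (x i s) (p i s) = b i • vecQ xA xB := by
    filter_upwards [F.ray, F.start, F.finish, hbB] with i hi h0 h1 hbi s hs
    rw [hi.neg_cross_eq hx h0 h1 hs, hbi]
  have hb1 : (fun i => b i - closestApproach xA xB) =O[l] m := by
    refine (F.impact_sub_isBigO hx hreg hl).congr' ?_ EventuallyEq.rfl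
    filter_upwards [hbB] with i hi
    rw [hi]
  have hblim : Tendsto b l (𝓝 (closestApproach xA xB)) := by
    simpa using (hb1.trans_tendsto F.mass_tendsto_zero).add_const (closestApproach xA xB)
  have hrc := closestApproach_pos hx
  have hbpos : ∀ᶠ i in l, closestApproach xA xB / 2 < b i ∧ b i < 2 * closestApproach xA xB :=
    (hblim.eventually_const_lt (by linarith)).and (hblim.eventually_lt_const (by linarith))
  have hpl : ∀ᶠ i in l, ∀ s ∈ Icc (0 : ℝ) 1, dot (p i s) (vecQ xA xB) = 0 := by
    filter_upwards [hL, hbpos] with i hi hbp s hs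
    have h2 : dot (p i s) (-cross (x i s) (p i s)) = 0 := by
      rw [← neg_one_smul ℝ, dot_smul_right, dot_cross_right, mul_zero]
    rw [hi s hs, dot_smul_right] at h2
    exact (mul_eq_zero.1 h2).resolve_left (by linarith)
  have e1 : Tendsto (fun i => (i, (1 : ℝ))) l (l ×ˢ 𝓟 (Icc 0 1)) := tendsto_prodMk_principal h11
  have e0 : Tendsto (fun i => (i, (0 : ℝ))) l (l ×ˢ 𝓟 (Icc 0 1)) := tendsto_prodMk_principal h00
  have hEA := (F.energy_isBigO h11 (F.finish.mono fun i hi => by rw [hi])).congr'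
    (f₂ := fun i => dot (p i 1) (vecN xA xB) ^ 2 + dot (p i 1) (vecP xA xB) ^ 2
      - (1 + 2 * (1 + γ) * (m i / ‖xA‖) + 2 * kappa β γ ε * (m i / ‖xA‖) ^ 2))
    (by filter_upwards [hpl] with i hi; rw [norm_sq_of_dot_vecQ_eq_zero hx (hi 1 h11)])
    EventuallyEq.rfl
  have hEB := (F.energy_isBigO h00 (F.start.mono fun i hi => by rw [hi])).congr'
    (f₂ := fun i => dot (p i 0) (vecN xA xB) ^ 2 + dot (p i 0) (vecP xA xB) ^ 2
      - (1 + 2 * (1 + γ) * (m i / ‖xB‖) + 2 * kappa β γ ε * (m i / ‖xB‖) ^ 2))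
    (by filter_upwards [hpl] with i hi; rw [norm_sq_of_dot_vecQ_eq_zero hx (hi 0 h00)])
    EventuallyEq.rfl
  have hD := F.deflection_isBigO hx hreg hl hbB rfl rfl rfl rfl rfl
  set tA := dot xA (vecN xA xB) with htA
  set tB := dot xB (vecN xA xB) with htB
  set rc := closestApproach xA xB with hrcdef
  set Φ := Real.arctan (tB / rc) - Real.arctan (tA / rc) with hΦ
  set H := ‖xA‖ * ‖xB‖ + tA * tB + rc ^ 2 with hH
  have hmain := second_order_expansions (Φ := Φ)
    (uA := fun i => dot (p i 1) (vecN xA xB)) (vA := fun i => dot (p i 1) (vecP xA xB))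
    (uB := fun i => dot (p i 0) (vecN xA xB)) (vB := fun i => dot (p i 0) (vecP xA xB)) hE hH F.mass_tendsto_zero hb1
    ((F.dot_direction_vecN_isBigO hx hreg hl).comp_tendsto e1)
    ((F.dot_direction_vecN_isBigO hx hreg hl).comp_tendsto e0)
    ((F.dot_direction_vecP_isBigO hx hreg hl).comp_tendsto e1)
    ((F.dot_direction_vecP_isBigO hx hreg hl).comp_tendsto e0) hEA hEB
    (by
      filter_upwards [F.finish] with i hi
      rw [hb i, hi, dot_neg_cross_vecQ hx, dot_left_vecP hx])
    (by
      filter_upwards [hbB] with i hi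
      rw [hi, dot_neg_cross_vecQ hx, dot_right_vecP hx])
    (hD.congr_left fun i => by rw [hΦ, neg_sub])
  obtain ⟨mb, muA, mvA, muB, mvB⟩ := hmain
  -- translation of the closed formulas
  have hA := hE.rA_pos.ne'
  have hB := hE.rB_pos.ne'
  have hc := hrc.ne'
  have hH0 : H ≠ 0 := hE.denom_pos.ne'
  have hR : tB - tA ≠ 0 := (sub_pos.2 hE.lt).ne'
  have hRn : ‖xB - xA‖ = tB - tA := (dot_right_vecN_sub hx).symm
  have f1 : ‖cross (vecN xA xB) (unit xA)‖ = rc / ‖xA‖ := norm_cross_vecN_left hx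
  have f2 : ‖cross (vecN xA xB) (unit xB)‖ = rc / ‖xB‖ := norm_cross_vecN_right hx
  have f3 : ‖cross (unit xA) (unit xB)‖ = rc * (tB - tA) / (‖xA‖ * ‖xB‖) := by
    rw [norm_cross_unit_unit hx, hRn]
  -- With `f1` to `f8` every vector expression in the statement becomes a function of t_A, t_B, r_A,
  -- r_B, r_c and the angle Φ.
  have f4 : 1 + dot (unit xA) (unit xB) = H / (‖xA‖ * ‖xB‖) := by
    rw [dot_unit_unit hx, hH]; field_simp; ring
  have f5 : Real.arccos (dot (unit xA) (unit xB)) = Φ := by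
    rw [dot_unit_unit hx, hΦ, hE.arctan_sub_arctan]
  have f6 : dot (vecN xA xB) (unit xA) = tA / ‖xA‖ := dot_vecN_unit xA
  have f7 : dot (vecN xA xB) (unit xB) = tB / ‖xB‖ := dot_vecN_unit xB
  have f8 : Φ / (rc * (tB - tA) / (‖xA‖ * ‖xB‖)) = Φ * (‖xA‖ * ‖xB‖ / (rc * (tB - tA))) := by
    field_simp
  have hvec : ∀ {u v : ι → ℝ}, u =O[l] (fun i => m i ^ 3) → v =O[l] (fun i => m i ^ 3) →
      (fun i => u i • vecN xA xB + v i • vecP xA xB) =O[l] fun i => m i ^ 3 := by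
    intro u v hu hv
    have hcst : ∀ w : Triple, (fun _ : ι => w) =O[l] fun _ => (1 : ℝ) := fun w =>
      isBigO_const_const _ one_ne_zero _
    have h1 := (hu.smul (hcst (vecN xA xB))).add (hv.smul (hcst (vecP xA xB)))
    simpa using h1
  refine ⟨hbpos, hL, ?_, ?_, ?_⟩
  · refine mb.congr_left fun i => ?_
    simp only [impactExpansion]
    rw [f1, f2, f3, f4, f5, f6, f7, f8, ← hrcdef]
    field_simp
    ring
  · refine (hvec muA mvA).congr' ?_ EventuallyEq.rfl
    filter_upwards [hpl] with i hi
    simp only [emissionExpansion]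
    rw [f1, f2, f3, f4, f5, f6, f7, f8]
    conv_rhs => rw [eq_of_dot_vecQ_eq_zero hx (hi 1 h11)]
    rw [show rc / ‖xB‖ / (H / (‖xA‖ * ‖xB‖)) = rc * ‖xA‖ / H by field_simp,
      show rc * (tB - tA) / (‖xA‖ * ‖xB‖) / (H / (‖xA‖ * ‖xB‖)) = rc * (tB - tA) / H by field_simp]
    module
  · refine (hvec muB mvB).congr' ?_ EventuallyEq.rfl
    filter_upwards [hpl] with i hi
    simp only [receptionExpansion]
    rw [f1, f2, f3, f4, f5, f6, f7, f8]
    conv_rhs => rw [eq_of_dot_vecQ_eq_zero hx (hi 0 h00)]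
    rw [show rc / ‖xA‖ / (H / (‖xA‖ * ‖xB‖)) = rc * ‖xB‖ / H by field_simp,
      show rc * (tB - tA) / (‖xA‖ * ‖xB‖) / (H / (‖xA‖ * ‖xB‖)) = rc * (tB - tA) / H by field_simp]
    module

end RayFamily

end Family

/-! ### Quasi-Minkowskian rays -/

/-- The terms at one value M inside the interval of convergence are bounded, so for m < M/2 the sum
is dominated by m/M times a geometric series. -/
lemma tendsto_zero_of_hasSum_pow {E : Type*} [NormedAddCommGroup E] [NormedSpace ℝ E]
    {c : ℕ → E} {f : ℝ → E} {m₁ : ℝ} (hm₁ : 0 < m₁)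
    (h : ∀ m ∈ Ioo 0 m₁, HasSum (fun n => m ^ (n + 1) • c n) (f m)) :
    Tendsto f (𝓝[>] 0) (𝓝 0) := by
  set M := m₁ / 2 with hM
  have hM0 : 0 < M := by positivity
  have hb : ∃ K, ∀ n, ‖M ^ (n + 1) • c n‖ ≤ K := by
    have := (h M ⟨hM0, half_lt_self hm₁⟩).summable.tendsto_atTop_zero.norm.bddAbove_range
    obtain ⟨K, hK⟩ := this
    exact ⟨K, fun n => hK ⟨n, rfl⟩⟩
  obtain ⟨K, hK⟩ := hb
  have hbound : ∀ᶠ m in 𝓝[>] (0 : ℝ), ‖f m‖ ≤ K * (m / M) * 2 := by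
    filter_upwards [Ioo_mem_nhdsGT (show 0 < M / 2 by positivity)] with m hm
    have hmM : m / M ≤ 1 / 2 := by rw [div_le_iff₀ hM0]; linarith [hm.2]
    have hmM0 : 0 < m / M := div_pos hm.1 hM0
    have hs := h m ⟨hm.1, by linarith [hm.2]⟩
    rw [← hs.tsum_eq]
    refine tsum_of_norm_bounded (hasSum_geometric_two.mul_left (K * (m / M))) fun n => ?_
    have e : m ^ (n + 1) • c n = (m / M) ^ (n + 1) • (M ^ (n + 1) • c n) := by
      rw [smul_smul, ← mul_pow, div_mul_cancel₀ _ hM0.ne']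
    rw [e, norm_smul, norm_pow, Real.norm_of_nonneg hmM0.le, pow_succ]
    calc (m / M) ^ n * (m / M) * ‖M ^ (n + 1) • c n‖
        ≤ (1 / 2) ^ n * (m / M) * K := by
          gcongr
          exact hK n
      _ = K * (m / M) * (1 / 2) ^ n := by ring
  refine squeeze_zero_norm' hbound ?_
  have : Tendsto (fun m : ℝ => K * (m / M) * 2) (𝓝 0) (𝓝 (K * (0 / M) * 2)) :=
    (Continuous.tendsto (by fun_prop) 0)
  simp only [zero_div, mul_zero, zero_mul] at this
  exact this.mono_left nhdsWithin_le_nhds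

namespace IsQuasiMinkowskian

variable {A B : ℝ → ℝ → ℝ} {k x0B m₁ : ℝ} {xA xB : Triple} {X : ℝ → ℝ → Event}

lemma tendsto (h : IsQuasiMinkowskian A B k xA xB x0B m₁ X) {s : ℝ} (hs : s ∈ Icc (0 : ℝ) 1) :
    Tendsto (fun m => X m s) (𝓝[>] 0) (𝓝 (straightRay xA xB x0B s)) := by
  obtain ⟨c, -, hc⟩ := h.expansion
  have := tendsto_zero_of_hasSum_pow (c := fun n => c (n + 1) s)
    (f := fun m => X m s - straightRay xA xB x0B s) h.m₁_pos fun m hm => hc m hm s hs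
  simpa using this.add_const (straightRay xA xB x0B s)

/-- All coefficients vanish at 0, so the ray starts at its prescribed event exactly for each m, not
merely in the limit. -/
lemma eq_start (h : IsQuasiMinkowskian A B k xA xB x0B m₁ X) {m : ℝ} (hm : m ∈ Ioo 0 m₁) :
    X m 0 = straightRay xA xB x0B 0 := by
  obtain ⟨c, hc0, hc⟩ := h.expansion
  have h1 := hc m hm 0 (left_mem_Icc.2 zero_le_one)
  simp only [(hc0 _ (Nat.le_add_left 1 _)).1, smul_zero] at h1
  exact sub_eq_zero.1 (h1.unique hasSum_zero)

lemma spatial_straightRay (s : ℝ) :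
    spatial (straightRay xA xB x0B s) = xB - s • (xB - xA) := by
  ext i; simp [spatial, straightRay]

lemma spatial_start (h : IsQuasiMinkowskian A B k xA xB x0B m₁ X) {m : ℝ} (hm : m ∈ Ioo 0 m₁) :
    spatial (X m 0) = xB := by
  rw [h.eq_start hm, spatial_straightRay, zero_smul, sub_zero]

lemma spatial_finish (h : IsQuasiMinkowskian A B k xA xB x0B m₁ X) {m : ℝ} (hm : m ∈ Ioo 0 m₁) :
    spatial (X m 1) = xA := by
  obtain ⟨c, hc0, hc⟩ := h.expansion
  have h1 := (hc m hm 1 (right_mem_Icc.2 zero_le_one)).mapL spatialCLM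
  simp only [map_smul, spatialCLM_apply, (hc0 _ (Nat.le_add_left 1 _)).2, smul_zero] at h1
  have h2 := h1.unique hasSum_zero
  rw [← spatialCLM_apply, map_sub, sub_eq_zero, spatialCLM_apply, spatialCLM_apply,
    spatial_straightRay] at h2
  rw [h2]; simp

end IsQuasiMinkowskian

/-! ### Uniformity over all rays -/

/-- All quasi-Minkowskian rays joining two given points, with the mass parameter tending to zero:
an estimate holds along this filter if and only if it holds, with the same constants, for every
ray and all sufficiently small masses. -/
def rayFilter (A B : ℝ → ℝ → ℝ) (k : ℝ) (xA xB : Triple) : Filter (ℝ × (ℝ → Event)) :=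
  ⨆ ξ : {ξ : ℝ × ℝ × (ℝ → ℝ → Event) // IsQuasiMinkowskian A B k xA xB ξ.1 ξ.2.1 ξ.2.2},
    map (fun m => (m, ξ.1.2.2 m)) (𝓝[>] 0)

section

variable {A B : ℝ → ℝ → ℝ} {k : ℝ} {xA xB : Triple}

lemma eventually_rayFilter {P : ℝ × (ℝ → Event) → Prop} :
    (∀ᶠ i in rayFilter A B k xA xB, P i) ↔ ∀ x0B m₁ X, IsQuasiMinkowskian A B k xA xB x0B m₁ X →
      ∀ᶠ m in 𝓝[>] (0 : ℝ), P (m, X m) := by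
  simp only [rayFilter, eventually_iSup, eventually_map]
  exact ⟨fun h x0B m₁ X hX => h ⟨(x0B, m₁, X), hX⟩, fun h ξ => h _ _ _ ξ.2⟩

lemma tendsto_rayFilter {E : Type*} {f : ℝ × (ℝ → Event) → E} {L : Filter E} :
    Tendsto f (rayFilter A B k xA xB) L ↔ ∀ x0B m₁ X, IsQuasiMinkowskian A B k xA xB x0B m₁ X →
      Tendsto (fun m => f (m, X m)) (𝓝[>] (0 : ℝ)) L := by
  simp only [rayFilter, tendsto_iSup, tendsto_map'_iff]
  exact ⟨fun h x0B m₁ X hX => h ⟨(x0B, m₁, X), hX⟩, fun h ξ => h _ _ _ ξ.2⟩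

lemma IsQuasiMinkowskian.eventually_mem_Ioo {x0B m₁ : ℝ} {X : ℝ → ℝ → Event}
    (h : IsQuasiMinkowskian A B k xA xB x0B m₁ X) : ∀ᶠ m in 𝓝[>] (0 : ℝ), m ∈ Ioo 0 m₁ :=
  Ioo_mem_nhdsGT h.m₁_pos

lemma tendsto_time {s : ℝ} (hs : s ∈ Icc (0 : ℝ) 1) :
    Tendsto (fun i => i.2 s 0 - i.2 0 0) (rayFilter A B k xA xB) (𝓝 (-(s * ‖xB - xA‖))) := by
  rw [tendsto_rayFilter]
  intro x0B m₁ X hX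
  have h1 := tendsto_pi_nhds.1 (hX.tendsto hs) 0
  have h2 := tendsto_pi_nhds.1 (hX.tendsto (left_mem_Icc.2 zero_le_one)) 0
  have := h1.sub h2
  simpa [straightRay] using this

lemma tendsto_spatial {s : ℝ} (hs : s ∈ Icc (0 : ℝ) 1) :
    Tendsto (fun i => spatial (i.2 s)) (rayFilter A B k xA xB) (𝓝 (xB - s • (xB - xA))) := by
  rw [tendsto_rayFilter]
  intro x0B m₁ X hX
  have := (spatialCLM.continuous.tendsto _).comp (hX.tendsto hs)
  rwa [spatialCLM_apply, IsQuasiMinkowskian.spatial_straightRay] at this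

end

lemma impactParameter_eq (g : Event → Matrix (Fin 4) (Fin 4) ℝ) (xA xB : Triple)
    (X : ℝ → Event) : impactParameter g xA xB X
      = dot (-cross (spatial (X 1)) (directionTriple g X 1)) (vecQ xA xB) := rfl

lemma rayFamily {β γ ε k : ℝ} {A B : ℝ → ℝ → ℝ} (hAB : IsPostMinkowskianPair β γ ε k A B)
    {xA xB : Triple} (hx : cross xA xB ≠ 0) :
    ∃ fA fC : ℝ → ℝ, RayFamily (rayFilter A B k xA xB) (1 / k) (1 + γ) (kappa β γ ε) fA fC
      (fun i => i.1) (fun i s => i.2 s 0) (fun i s => spatial (i.2 s))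
      (fun i => directionTriple (isotropicMetric (A i.1) (B i.1)) i.2)
      (fun i => covTangent (isotropicMetric (A i.1) (B i.1)) i.2 0 0) xA xB := by
  obtain ⟨fA, fC, hf, hA, hB⟩ := hAB.exists_opticalProfile
  have h11 : (1 : ℝ) ∈ Icc (0 : ℝ) 1 := right_mem_Icc.2 zero_le_one
  refine ⟨fA, fC, hf, ?_, ?_, ?_, ?_⟩
  · rw [tendsto_rayFilter]
    exact fun _ _ _ _ => tendsto_id
  -- For small m the emission time precedes the reception time, because the difference tends to
  -- −‖x_B − x_A‖ < 0; this supplies the sign of l₀.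
  · have ht := (tendsto_time (A := A) (B := B) (k := k) (xA := xA) (xB := xB) h11).eventually_lt_const
      (u := 0) (by simpa using sub_ne_zero_of_cross hx)
    rw [eventually_rayFilter] at ht ⊢
    intro x0B m₁ X hX
    filter_upwards [ht x0B m₁ X hX, hX.eventually_mem_Ioo] with m hm hm₁
    exact (hX.nullGeodesic m hm₁).isOpticalRay hAB.k_pos hm₁.1 hf (fun r => hA m r hm₁.1)
      (fun r => hB m r hm₁.1) (hX.exterior m hm₁) h11 (sub_neg.1 hm)
  · rw [eventually_rayFilter]
    intro x0B m₁ X hX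
    filter_upwards [hX.eventually_mem_Ioo] with m hm₁ using hX.spatial_start hm₁
  · rw [eventually_rayFilter]
    intro x0B m₁ X hX
    filter_upwards [hX.eventually_mem_Ioo] with m hm₁ using hX.spatial_finish hm₁

end LightRay
end

/-! ### Proof of the theorem -/

open LightRay
theorem proposition4 (β γ ε k : ℝ) (A B : ℝ → ℝ → ℝ) (hAB : IsPostMinkowskianPair β γ ε k A B)
    (xA xB : Triple) (hx : cross xA xB ≠ 0) :
    ∃ C : ℝ, 0 < C ∧ ∀ (x0B m₁ : ℝ) (X : ℝ → ℝ → Event),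
      IsQuasiMinkowskian A B k xA xB x0B m₁ X →
      ∀ᶠ m in 𝓝[>] (0 : ℝ),
        let g := isotropicMetric (A m) (B m)
        let b := impactParameter g xA xB (X m)
        0 < b ∧
        (∀ s ∈ Icc (0 : ℝ) 1, angularMomentum g (X m) s = b • vecQ xA xB) ∧
        |b - impactExpansion β γ ε xA xB m| ≤ C * (m ^ 3 / closestApproach xA xB ^ 2) ∧
        ‖directionTriple g (X m) 1 - emissionExpansion β γ ε xA xB m b‖ ≤ C * (m ^ 3 / b ^ 3) ∧
        ‖directionTriple g (X m) 0 - receptionExpansion β γ ε xA xB m b‖ ≤ C * (m ^ 3 / b ^ 3) := by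
  obtain ⟨fA, fC, F⟩ := rayFamily hAB hx
  have hxB : 0 < ‖xB‖ := norm_pos_iff.2 (right_ne_zero_of_cross hx)
  have hne := sub_ne_zero_of_cross hx
  have hR : 0 < ‖xB - xA‖ := norm_pos_iff.2 hne
  have hrc := closestApproach_pos hx
  -- This choice gives s₀ ≤ 1 and s₀‖x_B − x_A‖ ≤ ‖x_B‖/4, so the straight ray stays well away from
  -- the centre up to `s₀`.
  set s₀ := ‖xB‖ / (4 * (‖xB‖ + ‖xB - xA‖)) with hs₀
  have hs₀mem : s₀ ∈ Ioc (0 : ℝ) 1 := by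
    refine ⟨by positivity, ?_⟩
    rw [hs₀, div_le_one (by positivity)]
    linarith
  have hsmall : s₀ * ‖xB - xA‖ ≤ ‖xB‖ / 4 := by
    rw [hs₀, div_mul_eq_mul_div, div_le_div_iff₀ (by positivity) (by norm_num)]
    nlinarith
  have ht := tendsto_time (A := A) (B := B) (k := k) (xA := xA) (xB := xB)
    (Ioc_subset_Icc_self hs₀mem)
  have hreg₀ := F.staysAway_initial hs₀mem hsmall ht (div_pos hxB (by norm_num)) le_rfl
  have hl := F.tendsto_energy hs₀mem ht hreg₀
  have hreg := F.staysAway hx (F.tendsto_direction hs₀mem hne ht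
    (tendsto_spatial (Ioc_subset_Icc_self hs₀mem)) hreg₀)
  have hexp := F.expansions hx hreg hl
    (b := fun i => impactParameter (isotropicMetric (A i.1) (B i.1)) xA xB i.2)
    (by intro i; beta_reduce; exact impactParameter_eq _ xA xB i.2)
  obtain ⟨hb, hL, h1, h2, h3⟩ := hexp
  obtain ⟨C₁, hC₁, h1⟩ := h1.exists_pos
  obtain ⟨C₂, hC₂, h2⟩ := h2.exists_pos
  obtain ⟨C₃, hC₃, h3⟩ := h3.exists_pos
  have hm := F.mass_pos
  rw [Asymptotics.isBigOWith_iff] at h1 h2 h3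
  rw [eventually_rayFilter] at hb hL h1 h2 h3 hm
  set rc := closestApproach xA xB
  -- The estimates obtained are bounds by multiples of m³. The factor r_c² converts the first to
  -- m³/r_c², and (2r_c)³ converts the others to m³/b³ since b < 2r_c.
  refine ⟨C₁ * rc ^ 2 + (C₂ + C₃) * (2 * rc) ^ 3, by positivity, fun x0B m₁ X hX => ?_⟩
  filter_upwards [hb x0B m₁ X hX, hL x0B m₁ X hX, h1 x0B m₁ X hX, h2 x0B m₁ X hX, h3 x0B m₁ X hX,
    hm x0B m₁ X hX] with m hb hL h1 h2 h3 hm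
  intro g b
  have hb' : rc / 2 < b ∧ b < 2 * rc := hb
  have hb0 : 0 < b := by linarith
  have hm0 : 0 < m := hm
  have hcube : ∀ {D : ℝ}, 0 < D → D ≤ C₂ + C₃ →
      D * ‖m ^ 3‖ ≤ (C₁ * rc ^ 2 + (C₂ + C₃) * (2 * rc) ^ 3) * (m ^ 3 / b ^ 3) := by
    intro D hD hDle
    rw [Real.norm_of_nonneg (by positivity)]
    calc D * m ^ 3 = D * b ^ 3 * (m ^ 3 / b ^ 3) := by field_simp
      _ ≤ (0 + (C₂ + C₃) * (2 * rc) ^ 3) * (m ^ 3 / b ^ 3) := by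
          rw [zero_add]
          have := hb'.2.le
          gcongr
      _ ≤ _ := by gcongr; positivity
  refine ⟨hb0, hL, h1.trans ?_, h2.trans (hcube hC₂ (by linarith)),
    h3.trans (hcube hC₃ (by linarith))⟩
  rw [Real.norm_of_nonneg (by positivity)]
  calc C₁ * m ^ 3 = (C₁ * rc ^ 2 + 0) * (m ^ 3 / rc ^ 2) := by field_simp; ring
    _ ≤ _ := by gcongr; positivity
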